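/- Let $d\ge 0$ and let $R_d=\mathbb{Z}[u_1^{\pm1},\dots,u_d^{\pm1}]$ be the ring of Laurent polynomials; write $u^{\mathbf n}=u_1^{n_1}\cdots u_d^{n_d}$ for $\mathbf n\in\mathbb{Z}^d$. For an $R_d$-module $M$ let $X_M=\widehat M$ be the (compact) Pontryagin dual of the discrete abelian group $M$, and let $\alpha_M$ be the $\mathbb{Z}^d$-action on $X_M$ in which $\alpha_M^{\mathbf n}$ is the automorphism dual to multiplication by $u^{\mathbf n}$ on $M$, i.e. $(\alpha_M^{\mathbf n}x)(m)=x(u^{\mathbf n}\cdot m)$. If $M$ is Noetherian, then $X_M$ is metrizable; let $\rho$ be any metric inducing its topology. For a nonempty set $F\subset\mathbb{R}^d$, the action $\alpha_M$ is *expansive along* $F$ if there are $\varepsilon>0$ and $t>0$ such that, for all $x,y\in X_M$, $\rho(\alpha_M^{\mathbf n}x,\alpha_M^{\mathbf n}y)\le\varepsilon$ for every $\mathbf n\in\mathbb{Z}^d$ at Euclidean distance at most $t$ from $F$ implies $x=y$. Let $\operatorname{asc}(M)$ be the set of prime ideals of $R_d$ of the form $\{f\in R_d: f\cdot m=0\}$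 with $m\in M$. For an ideal $\mathfrak a$ of $R_d$ put $\mathsf V(\mathfrak a)=\{\mathbf z\in(\mathbb{C}^\times)^d: f(\mathbf z)=0 \text{ for all } f\in\mathfrak a\}$ and $\log|\mathsf V(\mathfrak a)|=\{(\log|z_1|,\dots,\log|z_d|):\mathbf z\in\mathsf V(\mathfrak a)\}\subset\mathbb{R}^d$. For a unit vector $\mathbf v\in\mathbb{R}^d$ let $H=\{\mathbf x\in\mathbb{R}^d:\mathbf x\cdot\mathbf v\le 0\}$ be the corresponding half-space and let $R_H=\mathbb{Z}[u^{\mathbf n}:\mathbf n\in H\cap\mathbb{Z}^d]\subset R_d$. An $R_d$-module is *Noetherian along* a subspace $V\subset\mathbb{R}^d$ if it is Noetherian as an $R_H$-module for every such half-space $H$ containing $V$. **Theorem.** Let $M$ be a Noetherian $R_d$-module and let $V$ be a linear subspace of $\mathbb{R}^d$, with orthogonal complement $V^\perp$. Then the following are equivalent. 1. $\alpha_M$ is expansive along $V$. 2. $\alpha_{R_d/\mathfrak p}$ is expansive along $V$ for every $\mathfrak p\in\operatorname{asc}(M)$. 3. For every $\mathfrak p\in\operatorname{asc}(M)$, $R_d/\mathfrak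 p$ is Noetherian along $V$ and $V^\perp\cap\log|\mathsf V(\mathfrak p)|=\emptyset$. The equivalence holds for every choice of compatible metrics on $X_M$ and on the groups $X_{R_d/\mathfrak p}$. -/

import Mathlib

noncomputable section

namespace AlgZd

open scoped ENNReal

/-! ### Actions of `ℤ^d` on compact metric spaces and expansiveness along subsets of `ℝ^d` -/

/-- `ℝ^d` with its Euclidean norm. -/
abbrev Euc (d : ℕ) : Type := EuclideanSpace ℝ (Fin d)

/-- The inclusion `ℤ^d ⊆ ℝ^d`. -/
def latticePoint {d : ℕ} (n : Fin d → ℤ) : Euc d := WithLp.toLp 2 fun i => (n i : ℝ)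

/-- A metric on the topological space `X` that induces the given topology. -/
def CompatibleMetric (X : Type*) [τ : TopologicalSpace X] : Type _ :=
  {ρ : MetricSpace X // ρ.toUniformSpace.toTopologicalSpace = τ}

/-- `ρ_β^F(x, y) = sup {ρ (β^n x, β^n y) : n ∈ F ∩ ℤ^d}`; it is `0` if `F ∩ ℤ^d = ∅`. The supremum
is taken in `[0, ∞]`, where it always exists. -/
def distAlong {d : ℕ} {X : Type*} [TopologicalSpace X] (ρ : CompatibleMetric X)
    (β : Multiplicative (Fin d → ℤ) →* (X ≃ₜ X)) (F : Set (Euc d)) (x y : X) : ℝ≥0∞ :=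
  letI := ρ.1
  ⨆ n : Fin d → ℤ, ⨆ _ : latticePoint n ∈ F,
    edist (β (Multiplicative.ofAdd n) x) (β (Multiplicative.ofAdd n) y)

/-- The `ℤ^d`-action `β` is expansive along `F ⊆ ℝ^d`: there are `ε > 0` and `t > 0` such that
`ρ_β^{F^t}(x, y) ≤ ε` implies `x = y`, where `F^t = {x : dist (x, F) ≤ t}`. -/
def ExpansiveAlong {d : ℕ} {X : Type*} [TopologicalSpace X] (ρ : CompatibleMetric X)
    (β : Multiplicative (Fin d → ℤ) →* (X ≃ₜ X)) (F : Set (Euc d)) : Prop :=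
  ∃ ε > (0 : ℝ), ∃ t > (0 : ℝ), ∀ x y : X,
    distAlong ρ β (Metric.cthickening t F) x y ≤ ENNReal.ofReal ε → x = y

/-! ### Laurent polynomials -/

/-- `R_d = ℤ[u₁^{±1}, …, u_d^{±1}]`, the group ring of `ℤ^d`. -/
abbrev LaurentRing (d : ℕ) : Type := AddMonoidAlgebra ℤ (Fin d → ℤ)

/-- The monomial `u^n`. -/
def monom {d : ℕ} (n : Fin d → ℤ) : LaurentRing d := AddMonoidAlgebra.single n 1

theorem monom_zero {d : ℕ} : monom (0 : Fin d → ℤ) = 1 := rfl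

theorem monom_add {d : ℕ} (m n : Fin d → ℤ) : monom (m + n) = monom m * monom n := by
  simp [monom, AddMonoidAlgebra.single_mul_single]

/-- The value `f(z) = ∑ c_f(n) z^n` of a Laurent polynomial at a point of `(ℂ^×)^d`. -/
def evalAt {d : ℕ} (f : LaurentRing d) (z : Fin d → ℂˣ) : ℂ :=
  ∑ n ∈ f.coeff.support, (f.coeff n : ℂ) * ∏ i, (z i : ℂ) ^ n i

/-- `V(𝔞)`, the set of common zeros of `𝔞` in `(ℂ^×)^d`. -/
def variety {d : ℕ} (a : Ideal (LaurentRing d)) : Set (Fin d → ℂˣ) :=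
  {z | ∀ f ∈ a, evalAt f z = 0}

/-- `log |z| = (log |z₁|, …, log |z_d|)`. -/
def logAbs {d : ℕ} (z : Fin d → ℂˣ) : Euc d := WithLp.toLp 2 fun i => Real.log ‖(z i : ℂ)‖

/-! ### The algebraic `ℤ^d`-action dual to an `R_d`-module -/

/-- The abelian group `M`, written multiplicatively and given the discrete topology. -/
def DiscreteMul (M : Type*) : Type _ := Multiplicative M

instance (M : Type*) [AddCommGroup M] : CommGroup (DiscreteMul M) :=
  inferInstanceAs (CommGroup (Multiplicative M))

instance (M : Type*) : TopologicalSpace (DiscreteMul M) := ⊥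

instance (M : Type*) : DiscreteTopology (DiscreteMul M) := ⟨rfl⟩

/-- `X_M`, the compact Pontryagin dual of the discrete group `M`. -/
abbrev DualGroup (M : Type*) [AddCommGroup M] : Type _ := PontryaginDual (DiscreteMul M)

section Action

variable {d : ℕ} (M : Type*) [AddCommGroup M] [Module (LaurentRing d) M]

/-- Multiplication by `u^n` on the discrete group `M`. -/
def mulMono (n : Fin d → ℤ) : DiscreteMul M →ₜ* DiscreteMul M where
  toMonoidHom := AddMonoidHom.toMultiplicative (DistribSMul.toAddMonoidHom M (monom n))
  continuous_toFun := continuous_of_discreteTopology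

theorem mulMono_zero (m : DiscreteMul M) : mulMono M (0 : Fin d → ℤ) m = m :=
  one_smul (LaurentRing d) (Multiplicative.toAdd m : M)

theorem mulMono_add (n k : Fin d → ℤ) (m : DiscreteMul M) :
    mulMono M (n + k) m = mulMono M n (mulMono M k m) := by
  have h : monom (n + k) • (Multiplicative.toAdd m : M)
      = monom n • monom k • (Multiplicative.toAdd m : M) := by
    rw [monom_add, mul_smul]
  exact h

/-- `α_M^n`, the automorphism of `X_M` dual to multiplication by `u^n`:
`(α_M^n x)(m) = x (u^n m)`. -/
def dualHomeo (n : Fin d → ℤ) : DualGroup M ≃ₜ DualGroup M where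
  toFun := PontryaginDual.map (mulMono M n)
  invFun := PontryaginDual.map (mulMono M (-n))
  left_inv x := by
    ext1 m
    rw [PontryaginDual.map_apply, PontryaginDual.map_apply, ← mulMono_add, add_neg_cancel,
      mulMono_zero]
  right_inv x := by
    ext1 m
    rw [PontryaginDual.map_apply, PontryaginDual.map_apply, ← mulMono_add, neg_add_cancel,
      mulMono_zero]
  continuous_toFun := (PontryaginDual.map (mulMono M n)).continuous_toFun
  continuous_invFun := (PontryaginDual.map (mulMono M (-n))).continuous_toFun

/-- The algebraic `ℤ^d`-action `α_M` on `X_M`. -/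
def dualAction : Multiplicative (Fin d → ℤ) →* (DualGroup M ≃ₜ DualGroup M) where
  toFun n := dualHomeo M (Multiplicative.toAdd n)
  map_one' := by
    refine Homeomorph.ext fun x => PontryaginDual.ext fun m => ?_
    exact congrArg x (mulMono_zero M m)
  map_mul' a b := by
    refine Homeomorph.ext fun x => PontryaginDual.ext fun m => ?_
    refine congrArg x ?_
    change mulMono M (Multiplicative.toAdd a + Multiplicative.toAdd b) m = _
    rw [add_comm]
    exact mulMono_add M _ _ m

/-- `asc(M)`: the prime ideals of the form `{f : f · m = 0}` with `m ∈ M`. -/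
def asc : Set (Ideal (LaurentRing d)) :=
  {p | p.IsPrime ∧ ∃ m : M, (p : Set (LaurentRing d)) = {f | f • m = 0}}

end Action

/-- The dual group of a Noetherian `R_d`-module is metrizable. -/
theorem nonempty_compatibleMetric {d : ℕ} (M : Type*) [AddCommGroup M] [Module (LaurentRing d) M]
    [IsNoetherian (LaurentRing d) M] : Nonempty (CompatibleMetric (DualGroup M)) := by
  have hR : Countable (LaurentRing d) :=
    Function.Injective.countable (f := fun f : LaurentRing d => f.coeff) fun f g h => by
      cases f; cases g; exact congrArg _ h
  have hM : Countable M := by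
    obtain ⟨n, f, hf⟩ := Module.Finite.exists_fin' (LaurentRing d) M
    exact hf.countable
  have hD : Countable (DiscreteMul M) := hM
  have he : Topology.IsEmbedding
      (ContinuousMonoidHom.toContinuousMap : (DiscreteMul M →ₜ* Circle) → C(DiscreteMul M, Circle)) :=
    ContinuousMonoidHom.isEmbedding_toContinuousMap _ _
  have : SecondCountableTopology (DiscreteMul M) := inferInstance
  have : SecondCountableTopology (DualGroup M) := he.secondCountableTopology
  have : TopologicalSpace.MetrizableSpace (DualGroup M) :=
    TopologicalSpace.metrizableSpace_of_t3_secondCountable _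
  exact ⟨⟨TopologicalSpace.metrizableSpaceMetric (DualGroup M), rfl⟩⟩

/-! ### The Noetherian condition along a subspace -/

/-- The half-space `H_v = {x : x · v ≤ 0}` (with outward unit normal `v` when `‖v‖ = 1`). -/
def halfSpace {d : ℕ} (v : Euc d) : Set (Euc d) := {x | inner ℝ x v ≤ 0}

/-- `R_H = ℤ[u^n : n ∈ H ∩ ℤ^d]`, a subring of `R_d`. -/
def subringOf {d : ℕ} (H : Set (Euc d)) : Subring (LaurentRing d) :=
  Subring.closure {f | ∃ n : Fin d → ℤ, latticePoint n ∈ H ∧ f = monom n}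

/-- `M` is Noetherian along the subspace `V`: it is `R_H`-Noetherian for every half-space
`H = H_v`, `‖v‖ = 1`, that contains `V`. -/
def NoetherianAlong {d : ℕ} (V : Submodule ℝ (Euc d)) (M : Type*) [AddCommGroup M]
    [Module (LaurentRing d) M] : Prop :=
  ∀ v : Euc d, ‖v‖ = 1 → (V : Set (Euc d)) ⊆ halfSpace v → IsNoetherian (subringOf (halfSpace v)) M

end AlgZd

end

noncomputable section

namespace AlgZd

/-! ### Lattice points and monomials -/

section Basic

variable {d : ℕ}

/-! The proof passes through a condition on an ideal `a`, `ExpansiveIdeal V a`: for every unit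
vector v orthogonal to V, `a` contains some 1 - g with g supported in the open half-space x · v < 0,
and no zero of `a` has its logarithmic modulus in Vᗮ. The main point is `expansiveAlong_iff`: the
action on the dual of M is expansive along V exactly when the annihilator of M satisfies this
condition.

Sufficiency (`eq_one_of_isSmall`): let χ be a character of R_d that is trivial on `a` and close to 1
at the monomials near V. As long as the angles of χ(u^n) are small, the relations from `a` hold for
them as real numbers, not just modulo 2π. By compactness of the unit sphere of Vᗮ, finitely many
elements 1 - g express each angle far from V through angles closer to V, so the angles grow at most
exponentially in the distance to V. The absence of zeros gives, by Gelfand theory in an ℓ¹-algebra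
with a matching exponential weight, an element h of the complexified ideal with 1 - h of tiny norm.
Pairing with 1 - h then halves any bound for the angles near V; hence they vanish there, and the
elements 1 - g spread triviality to all monomials.

Necessity: by duality, expansiveness makes M generated, as a group, by the translates of a finite
set by lattice points near V. A shift into a half-space followed by Nakayama's lemma yields the
elements 1 - g. A forbidden zero z would give an eigenfunctional M → ℂ for evaluation at z, bounded
on those translates; exponentiating a small multiple of its real part gives a nontrivial character
that contradicts expansiveness.

Finally, each half of the condition can fail for the annihilator only through a prime containing it,
and such a prime contains an associated prime (`expansiveIdeal_annihilator_iff`). For a cyclic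
module R_d/p the existence of the elements 1 - g is the Noetherian condition along V
(`expansiveIdeal_iff`). -/

theorem latticePoint_zero : latticePoint (0 : Fin d → ℤ) = 0 := by
  ext i; simp [latticePoint]

theorem latticePoint_add (m n : Fin d → ℤ) :
    latticePoint (m + n) = latticePoint m + latticePoint n := by
  ext i; simp [latticePoint]

theorem latticePoint_nsmul (j : ℕ) (n : Fin d → ℤ) :
    latticePoint (j • n) = (j : ℝ) • latticePoint n := by
  ext i; simp [latticePoint]

theorem coeff_support_mul {R : Type*} [Semiring R] {f g : AddMonoidAlgebra R (Fin d → ℤ)}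
    {k : Fin d → ℤ} (hk : k ∈ (f * g).coeff.support) :
    ∃ a ∈ f.coeff.support, ∃ b ∈ g.coeff.support, a + b = k := by
  classical
  by_contra! hne
  rw [Finsupp.mem_support_iff, AddMonoidAlgebra.coeff_mul] at hk
  refine hk (Finset.sum_eq_zero fun a ha => Finset.sum_eq_zero fun b hb => ?_)
  exact if_neg (hne a ha b hb)

theorem laurent_eq_sum (f : LaurentRing d) :
    f = ∑ k ∈ f.coeff.support, f.coeff k • monom k := by
  conv_lhs => rw [← AddMonoidAlgebra.sum_coeff_single f]
  refine Finset.sum_congr rfl fun k _ => ?_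
  rw [monom, AddMonoidAlgebra.smul_single, smul_eq_mul, mul_one]

instance : IsNoetherianRing (LaurentRing d) :=
  Algebra.FiniteType.isNoetherianRing ℤ _

/-! ### Elements supported in open and closed half-spaces -/

/-- The support of `f` lies in the open half-space `{x : x · v < 0}`. -/
def StrictSupport (v : Euc d) (f : LaurentRing d) : Prop :=
  ∀ k ∈ f.coeff.support, inner ℝ (latticePoint k) v < 0

/-- The support of `f` lies in the closed half-space `{x : x · v ≤ 0}`. -/
def WeakSupport (v : Euc d) (f : LaurentRing d) : Prop :=
  ∀ k ∈ f.coeff.support, inner ℝ (latticePoint k) v ≤ 0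

theorem coeff_support_add {f g : LaurentRing d} {k : Fin d → ℤ}
    (hk : k ∈ (f + g).coeff.support) : k ∈ f.coeff.support ∨ k ∈ g.coeff.support := by
  classical
  simpa using Finsupp.support_add hk

theorem StrictSupport.zero {v : Euc d} : StrictSupport v 0 := by
  intro k hk; simp at hk

theorem StrictSupport.add {v : Euc d} {f g : LaurentRing d} (hf : StrictSupport v f)
    (hg : StrictSupport v g) : StrictSupport v (f + g) := fun k hk =>
  (coeff_support_add hk).elim (hf k) (hg k)

theorem StrictSupport.neg {v : Euc d} {f : LaurentRing d} (hf : StrictSupport v f) :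
    StrictSupport v (-f) := fun k hk => hf k (by simpa using hk)

theorem StrictSupport.weak {v : Euc d} {f : LaurentRing d} (hf : StrictSupport v f) :
    WeakSupport v f := fun k hk => (hf k hk).le

theorem WeakSupport.mul_strict {v : Euc d} {f g : LaurentRing d} (hf : WeakSupport v f)
    (hg : StrictSupport v g) : StrictSupport v (f * g) := by
  intro k hk
  obtain ⟨a, ha, b, hb, rfl⟩ := coeff_support_mul hk
  rw [latticePoint_add, inner_add_left]
  linarith [hf a ha, hg b hb]

theorem WeakSupport.mul {v : Euc d} {f g : LaurentRing d} (hf : WeakSupport v f)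
    (hg : WeakSupport v g) : WeakSupport v (f * g) := by
  intro k hk
  obtain ⟨a, ha, b, hb, rfl⟩ := coeff_support_mul hk
  rw [latticePoint_add, inner_add_left]
  linarith [hf a ha, hg b hb]

theorem coeff_support_monom (n : Fin d → ℤ) {k : Fin d → ℤ}
    (hk : k ∈ (monom n).coeff.support) : k = n := by
  classical
  rw [monom, AddMonoidAlgebra.coeff_single] at hk
  simpa using Finsupp.support_single_subset hk

theorem mem_subringOf_halfSpace {v : Euc d} {f : LaurentRing d} :
    f ∈ subringOf (halfSpace v) ↔ WeakSupport v f := by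
  constructor
  · intro hf
    induction hf using Subring.closure_induction with
    | mem x hx =>
      obtain ⟨n, hn, rfl⟩ := hx
      intro k hk
      rw [coeff_support_monom n hk]
      exact hn
    | zero => exact StrictSupport.zero.weak
    | one =>
      intro k hk
      rw [← monom_zero] at hk
      rw [coeff_support_monom 0 hk, latticePoint_zero, inner_zero_left]
    | add x y _ _ hx hy => exact fun k hk => (coeff_support_add hk).elim (hx k) (hy k)
    | neg x _ hx => exact fun k hk => hx k (by simpa using hk)
    | mul x y _ _ hx hy => exact hx.mul hy
  · intro hf
    rw [laurent_eq_sum f]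
    refine sum_mem fun k hk => zsmul_mem ?_ _
    exact Subring.subset_closure (s := {f | ∃ n : Fin d → ℤ, latticePoint n ∈ halfSpace v ∧
      f = monom n}) ⟨k, hf k hk, rfl⟩

/-- The multiplicative monoid of the elements `1 - g` with `g` supported in `{x : x · v < 0}`. -/
def oneSubStrict (v : Euc d) : Submonoid (LaurentRing d) where
  carrier := {f | StrictSupport v (1 - f)}
  one_mem' := by
    rw [Set.mem_ofPred_eq, sub_self]; exact StrictSupport.zero
  mul_mem' {a b} ha hb := by
    have h : 1 - a * b = (1 - a) + ((1 - b) + -((1 - a) * (1 - b))) := by ring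
    rw [Set.mem_ofPred_eq, h]
    exact StrictSupport.add ha (StrictSupport.add hb (ha.weak.mul_strict hb).neg)

theorem mem_oneSubStrict {v : Euc d} {f : LaurentRing d} :
    f ∈ oneSubStrict v ↔ StrictSupport v (1 - f) := Iff.rfl

theorem exists_inner_neg {v : Euc d} (hv : ‖v‖ = 1) :
    ∃ k : Fin d → ℤ, inner ℝ (latticePoint k) v < 0 := by
  have hv0 : v ≠ 0 := by rintro rfl; simp at hv
  obtain ⟨i, hi⟩ : ∃ i, v i ≠ 0 := by
    by_contra! h
    exact hv0 (by ext i; simpa using h i)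
  have key : ∀ c : ℤ, inner ℝ (latticePoint (Pi.single i c)) v = c * v i := by
    intro c
    rw [PiLp.inner_apply, Finset.sum_eq_single i]
    · simp [latticePoint, mul_comm]
    · intro j _ hj; simp [latticePoint, hj]
    · simp
  rcases lt_or_gt_of_ne hi with h | h
  · exact ⟨Pi.single i 1, by rw [key]; simpa using h⟩
  · exact ⟨Pi.single i (-1), by rw [key]; simpa using h⟩

/-! ### Evaluation of Laurent polynomials -/

/-- Monomials are units, so their images are nonzero, and multiplicativity reduces them to the
images of the variables. -/
theorem exists_evalAt_eq (ψ : LaurentRing d →+* ℂ) :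
    ∃ z : Fin d → ℂˣ, (∀ f, ψ f = evalAt f z) ∧
      ∀ n, ψ (monom n) = ∏ i, (z i : ℂ) ^ n i := by
  let u : Multiplicative (Fin d → ℤ) →* ℂˣ := Units.liftRight
    (ψ.toMonoidHom.comp (AddMonoidAlgebra.of ℤ (Fin d → ℤ)))
    (fun n => ⟨ψ (monom n.toAdd), ψ (monom (-n.toAdd)),
      by rw [← map_mul, ← monom_add, add_neg_cancel, monom_zero, map_one],
      by rw [← map_mul, ← monom_add, neg_add_cancel, monom_zero, map_one]⟩) (fun n => rfl)
  have hu : ∀ n, ψ (monom n) = u (Multiplicative.ofAdd n) := fun n => rfl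
  have hprod : ∀ n : Fin d → ℤ, ψ (monom n)
      = ∏ i, ((u (Multiplicative.ofAdd (Pi.single i 1)) : ℂˣ) : ℂ) ^ n i := by
    intro n
    have hn : Multiplicative.ofAdd n
        = ∏ i, (Multiplicative.ofAdd (Pi.single i (1 : ℤ) : Fin d → ℤ)) ^ n i := by
      rw [← Multiplicative.toAdd.injective.eq_iff, toAdd_prod]
      simp only [toAdd_ofAdd, toAdd_zpow]
      ext j
      simp [Finset.sum_apply, Pi.single_apply]
    rw [hu, hn, map_prod, Units.coe_prod]
    simp
  refine ⟨fun i => u (Multiplicative.ofAdd (Pi.single i 1)), fun f => ?_, hprod⟩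
  conv_lhs => rw [laurent_eq_sum f]
  rw [map_sum, evalAt]
  refine Finset.sum_congr rfl fun k _ => ?_
  rw [map_zsmul, hprod, zsmul_eq_mul]

/-- Evaluation at a point of `(ℂ^×)^d`, as a ring homomorphism. -/
def evalHom (z : Fin d → ℂˣ) : LaurentRing d →+* ℂ :=
  AddMonoidAlgebra.liftNCRingHom (Int.castRingHom ℂ)
    { toFun := fun n => ∏ i, (z i : ℂ) ^ (n.toAdd i)
      map_one' := by simp
      map_mul' := fun m n => by
        rw [← Finset.prod_mul_distrib]
        exact Finset.prod_congr rfl fun i _ => zpow_add₀ (z i).ne_zero _ _ }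
    (fun _ _ => Commute.all _ _)

theorem evalHom_monom (z : Fin d → ℂˣ) (n : Fin d → ℤ) :
    evalHom z (monom n) = ∏ i, (z i : ℂ) ^ n i := by
  rw [evalHom, monom, AddMonoidAlgebra.liftNCRingHom_single]
  simp

theorem evalHom_apply (z : Fin d → ℂˣ) (f : LaurentRing d) : evalHom z f = evalAt f z := by
  conv_lhs => rw [laurent_eq_sum f]
  rw [map_sum, evalAt]
  refine Finset.sum_congr rfl fun k _ => ?_
  rw [map_zsmul, evalHom_monom, zsmul_eq_mul]

theorem norm_prod_zpow (z : Fin d → ℂˣ) (n : Fin d → ℤ) :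
    ‖∏ i, (z i : ℂ) ^ n i‖ = Real.exp (inner ℝ (latticePoint n) (logAbs z)) := by
  rw [norm_prod, PiLp.inner_apply, Real.exp_sum]
  refine Finset.prod_congr rfl fun i _ => ?_
  have hz : 0 < ‖(z i : ℂ)‖ := norm_pos_iff.2 (z i).ne_zero
  rw [norm_zpow, ← Real.rpow_intCast, Real.rpow_def_of_pos hz]
  simp [latticePoint, logAbs]

/-! ### Distance from a subspace -/

/-- The distance from the lattice point `n` to the subspace `V`. -/
def codist (V : Submodule ℝ (Euc d)) (n : Fin d → ℤ) : ℝ :=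
  ‖Vᗮ.starProjection (latticePoint n)‖

variable (V : Submodule ℝ (Euc d))

theorem codist_nonneg (n : Fin d → ℤ) : 0 ≤ codist V n := norm_nonneg _

theorem codist_zero : codist V 0 = 0 := by simp [codist, latticePoint_zero]

theorem codist_add_le (m n : Fin d → ℤ) : codist V (m + n) ≤ codist V m + codist V n := by
  rw [codist, latticePoint_add, map_add]; exact norm_add_le _ _

theorem codist_le_of_mem {y : Euc d} (hy : y ∈ V) (n : Fin d → ℤ) :
    codist V n ≤ ‖latticePoint n - y‖ := by
  have h : Vᗮ.starProjection y = 0 :=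
    (Submodule.starProjection_apply_eq_zero_iff _).2 (by simpa using hy)
  calc codist V n = ‖Vᗮ.starProjection (latticePoint n - y)‖ := by
          rw [map_sub, h, sub_zero, codist]
    _ ≤ ‖latticePoint n - y‖ := Submodule.norm_starProjection_apply_le _ _

theorem exists_latticePoint_near (d : ℕ) :
    ∃ D : ℝ, ∀ x : Euc d, ∃ n : Fin d → ℤ, ‖latticePoint n - x‖ ≤ D := by
  refine ⟨√d, fun x => ⟨fun i => ⌊x i⌋, ?_⟩⟩
  rw [EuclideanSpace.norm_eq]
  refine Real.sqrt_le_sqrt ?_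
  calc ∑ i, ‖(latticePoint (fun i => ⌊x i⌋) - x) i‖ ^ 2 ≤ ∑ _i : Fin d, (1 : ℝ) := by
        refine Finset.sum_le_sum fun i _ => ?_
        have h1 := Int.floor_le (x i)
        have h2 := (Int.lt_floor_add_one (x i)).le
        refine pow_le_one₀ (norm_nonneg _) ?_
        rw [Real.norm_eq_abs, abs_le]
        constructor <;> simp only [latticePoint, PiLp.sub_apply] <;> linarith
    _ = d := by simp

theorem mem_cthickening_iff {t : ℝ} (ht : 0 ≤ t) (n : Fin d → ℤ) :
    latticePoint n ∈ Metric.cthickening t (V : Set (Euc d)) ↔ codist V n ≤ t := by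
  have hV : (V : Set (Euc d)).Nonempty := ⟨0, V.zero_mem⟩
  constructor
  · intro h
    have h1 : Metric.infDist (latticePoint n) (V : Set (Euc d)) ≤ t :=
      ENNReal.toReal_le_of_le_ofReal ht h
    refine le_trans ?_ h1
    rw [Metric.le_infDist hV]
    intro y hy
    exact (codist_le_of_mem V hy n).trans_eq (dist_eq_norm _ _).symm
  · intro h
    refine Metric.mem_cthickening_of_dist_le _ (V.starProjection (latticePoint n)) _ _
      (Submodule.starProjection_apply_mem _ _) ?_
    rw [dist_eq_norm]
    have h3 := Submodule.starProjection_add_starProjection_orthogonal (K := V) (latticePoint n)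
    rw [show latticePoint n - V.starProjection (latticePoint n)
      = Vᗮ.starProjection (latticePoint n) from sub_eq_of_eq_add' h3.symm]
    exact h

theorem inner_eq_inner_proj {v : Euc d} (hv : v ∈ Vᗮ) (x : Euc d) :
    inner ℝ x v = inner ℝ (Vᗮ.starProjection x) v := by
  nth_rw 1 [← Submodule.starProjection_add_starProjection_orthogonal (K := V) x]
  rw [inner_add_left, Submodule.inner_right_of_mem_orthogonal
    (Submodule.starProjection_apply_mem _ _) hv, zero_add]

theorem inner_le_codist {v : Euc d} (hv : v ∈ Vᗮ) (n : Fin d → ℤ) :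
    inner ℝ (latticePoint n) v ≤ codist V n * ‖v‖ := by
  rw [inner_eq_inner_proj V hv]
  exact real_inner_le_norm _ _

theorem subset_halfSpace_iff {v : Euc d} : (V : Set (Euc d)) ⊆ halfSpace v ↔ v ∈ Vᗮ := by
  rw [Submodule.mem_orthogonal]
  constructor
  · intro h u hu
    have h1 : inner ℝ u v ≤ 0 := h hu
    have h2 : inner ℝ (-u) v ≤ 0 := h (V.neg_mem hu)
    rw [inner_neg_left] at h2
    linarith
  · exact fun h u hu => (h u hu).le

end Basic

/-! ### Field-valued functionals on finitely generated modules -/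

open scoped TensorProduct in
theorem exists_linearMap_of_nontrivial_tensorProduct {A K M : Type*} [CommRing A] [Field K]
    [Algebra A K] [AddCommGroup M] [Module A M] [Nontrivial (K ⊗[A] M)] :
    ∃ φ : M →ₗ[A] K, φ ≠ 0 := by
  by_contra! hzero
  obtain ⟨t, ht⟩ := exists_ne (0 : K ⊗[A] M)
  refine ht ((Module.forall_dual_apply_eq_zero_iff K t).1 fun l => ?_)
  -- For fixed c, m ↦ l(c ⊗ m) is an A-linear map from M to K, hence zero.
  have h1 : l.restrictScalars A = 0 := TensorProduct.ext' fun c m =>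
    LinearMap.congr_fun
      (hzero ((l.restrictScalars A).comp (TensorProduct.mk A K M c))) m
  exact LinearMap.congr_fun h1 t

-- The support of a finite module is the zero locus of its annihilator, so the fibre of M at q is
-- nonzero.
open scoped TensorProduct in
theorem exists_linearMap_residueField {A M : Type*} [CommRing A] [AddCommGroup M]
    [Module A M] [Module.Finite A M] (q : PrimeSpectrum A)
    (h : Module.annihilator A M ≤ q.asIdeal) :
    ∃ φ : M →ₗ[A] q.asIdeal.ResidueField, φ ≠ 0 := by
  have : Nontrivial (q.asIdeal.ResidueField ⊗[A] M) := by
    rw [← Module.mem_support_iff_nontrivial_residueField_tensorProduct,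
      Module.support_eq_zeroLocus]
    exact h
  exact exists_linearMap_of_nontrivial_tensorProduct

/-- The map ψ factors through the residue field of its kernel, where the previous lemma supplies a
functional. -/
theorem exists_semilinear_functional {A K M : Type*} [CommRing A] [Field K] [AddCommGroup M]
    [Module A M] [Module.Finite A M] (ψ : A →+* K)
    (h : Module.annihilator A M ≤ RingHom.ker ψ) :
    ∃ φ : M →+ K, φ ≠ 0 ∧ ∀ (f : A) (m : M), φ (f • m) = ψ f * φ m := by
  have hprime := RingHom.ker_isPrime ψ
  obtain ⟨l, hl⟩ := exists_linearMap_residueField ⟨RingHom.ker ψ, hprime⟩ h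
  let ι : (RingHom.ker ψ).ResidueField →+* K := Ideal.ResidueField.lift _ ψ le_rfl
    fun f hf => (isUnit_iff_ne_zero.2 hf : IsUnit (ψ f))
  have hι : ∀ f, ι (algebraMap _ _ f) = ψ f := fun f =>
    Ideal.ResidueField.lift_algebraMap _ _ _ _ _
  refine ⟨ι.toAddMonoidHom.comp l.toAddMonoidHom, fun h0 => hl ?_, fun f m => ?_⟩
  · ext m
    exact ι.injective ((DFunLike.congr_fun h0 m).trans (map_zero ι).symm)
  · have h1 : l (f • m) = algebraMap _ _ f * l m := by
      rw [map_smul, Algebra.smul_def]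
    rw [← hι, AddMonoidHom.comp_apply, AddMonoidHom.comp_apply]
    exact (congrArg ι h1).trans (map_mul ι _ _)

/-! ### The algebraic form of expansiveness along a subspace -/

section Algebraic

variable {d : ℕ}

/-- The condition on the annihilator of a module that characterizes expansiveness along `V`. -/
def ExpansiveIdeal (V : Submodule ℝ (Euc d)) (a : Ideal (LaurentRing d)) : Prop :=
  (∀ v ∈ Vᗮ, ‖v‖ = 1 → ∃ f ∈ oneSubStrict v, f ∈ a) ∧
    ∀ z ∈ variety a, logAbs z ∉ Vᗮ

/-! ### Noetherianity over a half-space ring -/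

theorem StrictSupport.exists_le {v : Euc d} {g : LaurentRing d} (hg : StrictSupport v g) :
    ∃ δ > (0 : ℝ), ∀ k ∈ g.coeff.support, inner ℝ (latticePoint k) v ≤ -δ := by
  rcases g.coeff.support.eq_empty_or_nonempty with h | h
  · exact ⟨1, one_pos, by simp [h]⟩
  · obtain ⟨k, hk, hmax⟩ :=
      Finset.exists_max_image _ (fun k => inner ℝ (latticePoint k) v) h
    exact ⟨-inner ℝ (latticePoint k) v, neg_pos.2 (hg k hk), fun l hl => by
      rw [neg_neg]; exact hmax l hl⟩

/-- The support of g is finite, so each factor g pushes supports a fixed distance δ further in the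
direction -v. -/
theorem StrictSupport.exists_weakSupport {v : Euc d} {g : LaurentRing d}
    (hg : StrictSupport v g) (f : LaurentRing d) : ∃ j : ℕ, WeakSupport v (g ^ j * f) := by
  obtain ⟨δ, hδ, hle⟩ := hg.exists_le
  have hpow : ∀ j : ℕ, ∀ k ∈ (g ^ j * f).coeff.support,
      ∃ l ∈ f.coeff.support, inner ℝ (latticePoint k) v ≤ inner ℝ (latticePoint l) v - j * δ := by
    intro j
    induction j with
    | zero => intro k hk; exact ⟨k, by simpa using hk, by simp⟩
    | succ j ih =>
      intro k hk
      rw [pow_succ', mul_assoc] at hk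
      obtain ⟨a, ha, b, hb, rfl⟩ := coeff_support_mul hk
      obtain ⟨l, hl, hbl⟩ := ih b hb
      refine ⟨l, hl, ?_⟩
      rw [latticePoint_add, inner_add_left]
      push_cast
      linarith [hle a ha]
  obtain ⟨C, hC⟩ : ∃ C : ℝ, ∀ l ∈ f.coeff.support, inner ℝ (latticePoint l) v ≤ C :=
    ⟨∑ l ∈ f.coeff.support, |inner ℝ (latticePoint l) v|, fun l hl =>
      (le_abs_self _).trans (Finset.single_le_sum
        (f := fun l => |inner ℝ (latticePoint l) v|) (fun _ _ => abs_nonneg _) hl)⟩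
  obtain ⟨j, hj⟩ := exists_nat_ge (C / δ)
  refine ⟨j, fun k hk => ?_⟩
  obtain ⟨l, hl, h⟩ := hpow j k hk
  have := (div_le_iff₀ hδ).1 hj
  linarith [hC l hl]

/-- Since g = 1 - f acts as the identity on M, r • m = (g ^ j * r) • m, and g ^ j * r lies in R_H
for large j. Thus every R_H-submodule is already an R_d-submodule. -/
theorem isNoetherian_halfSpace {M : Type*} [AddCommGroup M] [Module (LaurentRing d) M]
    [IsNoetherian (LaurentRing d) M] {v : Euc d} {f : LaurentRing d} (hf : f ∈ oneSubStrict v)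
    (hM : ∀ m : M, f • m = 0) : IsNoetherian (subringOf (halfSpace v)) M := by
  have hg : ∀ m : M, (1 - f) • m = m := fun m => by rw [sub_smul, one_smul, hM, sub_zero]
  have hpow : ∀ (j : ℕ) (m : M), (1 - f) ^ j • m = m := by
    intro j m
    induction j with
    | zero => simp
    | succ j ih => rw [pow_succ, mul_smul, hg, ih]
  let F : Submodule (subringOf (halfSpace v)) M → Submodule (LaurentRing d) M := fun N =>
    { N.toAddSubmonoid with
      smul_mem' := fun r m hm => by
        obtain ⟨j, hj⟩ := StrictSupport.exists_weakSupport hf r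
        have h := N.smul_mem ⟨_, mem_subringOf_halfSpace.2 hj⟩ hm
        rwa [Subring.smul_def, mul_smul, hpow] at h }
  have hF : StrictMono F := fun N N' h => h
  rw [isNoetherian_iff']
  exact hF.wellFoundedGT

/-- For k inside the half-space, the R_H-submodules generated by u^(-jk) form an ascending chain.
Once it stabilizes, u^(-(n+1)k) ≡ r u^(-nk) modulo p with r in R_H; multiplying by u^((n+1)k) puts 1
- r u^k into p. -/
theorem exists_mem_oneSubStrict_of_isNoetherian {p : Ideal (LaurentRing d)} {v : Euc d}
    (hv : ‖v‖ = 1) (h : IsNoetherian (subringOf (halfSpace v)) (LaurentRing d ⧸ p)) :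
    ∃ f ∈ oneSubStrict v, f ∈ p := by
  obtain ⟨k, hk⟩ := exists_inner_neg hv
  have hcc : monom k * monom (-k) = 1 := by rw [← monom_add, add_neg_cancel, monom_zero]
  have hkw : WeakSupport v (monom k) := fun l hl => by
    rw [coeff_support_monom k hl]; exact hk.le
  let N : ℕ → Submodule (subringOf (halfSpace v)) (LaurentRing d ⧸ p) := fun j =>
    Submodule.span _ {Ideal.Quotient.mk p (monom (-k) ^ j)}
  have hN : Monotone N := by
    refine monotone_nat_of_le_succ fun j => ?_
    rw [Submodule.span_singleton_le_iff_mem, Submodule.mem_span_singleton]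
    refine ⟨⟨monom k, mem_subringOf_halfSpace.2 hkw⟩, ?_⟩
    rw [Subring.smul_def, ← Ideal.Quotient.mk_eq_mk, ← Submodule.Quotient.mk_smul,
      smul_eq_mul, pow_succ', ← mul_assoc, hcc, one_mul]
    rfl
  obtain ⟨n, hn⟩ := monotone_stabilizes_iff_noetherian.2 h ⟨N, hN⟩
  have hmem : Ideal.Quotient.mk p (monom (-k) ^ (n + 1)) ∈ N n := by
    have h1 : N n = N (n + 1) := hn (n + 1) n.le_succ
    rw [h1]
    exact Submodule.mem_span_singleton_self _
  obtain ⟨⟨r, hr⟩, hrn⟩ := Submodule.mem_span_singleton.1 hmem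
  have hr' : Ideal.Quotient.mk p (r * monom (-k) ^ n)
      = Ideal.Quotient.mk p (monom (-k) ^ (n + 1)) := hrn
  refine ⟨1 - r * monom k, ?_, ?_⟩
  · rw [mem_oneSubStrict, sub_sub_cancel]
    refine (mem_subringOf_halfSpace.1 hr).mul_strict fun l hl => ?_
    rw [coeff_support_monom k hl]; exact hk
  · have hpowc : monom k ^ (n + 1) * monom (-k) ^ (n + 1) = 1 := by
      rw [← mul_pow, hcc, one_pow]
    have h2 : 1 - r * monom k
        = monom k ^ (n + 1) * (monom (-k) ^ (n + 1) - r * monom (-k) ^ n) := by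
      have h3 : monom k ^ (n + 1) * monom (-k) ^ n = monom k := by
        rw [pow_succ', mul_assoc, ← mul_pow, hcc, one_pow, mul_one]
      rw [mul_sub, hpowc, mul_left_comm, h3]
    rw [h2]
    exact Ideal.mul_mem_left _ _ (Ideal.Quotient.eq.1 hr'.symm)

theorem expansiveIdeal_iff (V : Submodule ℝ (Euc d)) (p : Ideal (LaurentRing d)) :
    ExpansiveIdeal V p ↔ NoetherianAlong V (LaurentRing d ⧸ p) ∧
      (Vᗮ : Set (Euc d)) ∩ logAbs '' variety p = ∅ := by
  refine and_congr ⟨fun h v hv hV => ?_, fun h v hV hv => ?_⟩ ?_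
  · obtain ⟨f, hf, hfp⟩ := h v ((subset_halfSpace_iff V).1 hV) hv
    refine isNoetherian_halfSpace hf fun m => ?_
    obtain ⟨r, rfl⟩ := Ideal.Quotient.mk_surjective m
    exact Ideal.Quotient.eq_zero_iff_mem.2 (p.mul_mem_right r hfp)
  · exact exists_mem_oneSubStrict_of_isNoetherian hv (h v hv ((subset_halfSpace_iff V).2 hV))
  · rw [Set.eq_empty_iff_forall_notMem]
    constructor
    · rintro h _ ⟨hV, z, hz, rfl⟩
      exact h z hz hV
    · exact fun h z hz hV => h _ ⟨hV, z, hz, rfl⟩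

theorem ExpansiveIdeal.mono {V : Submodule ℝ (Euc d)} {a b : Ideal (LaurentRing d)}
    (h : ExpansiveIdeal V a) (hab : a ≤ b) : ExpansiveIdeal V b :=
  ⟨fun v hV hv => (h.1 v hV hv).imp fun _ hf => ⟨hf.1, hab hf.2⟩,
    fun z hz => h.2 z fun f hf => hz f (hab hf)⟩

/-! ### From the annihilator to the associated primes -/

section Module

variable {M : Type*} [AddCommGroup M] [Module (LaurentRing d) M]

theorem annihilator_le_of_mem_asc {p : Ideal (LaurentRing d)} (hp : p ∈ asc M) :
    Module.annihilator (LaurentRing d) M ≤ p := by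
  obtain ⟨-, m, hm⟩ := hp
  intro f hf
  have : f ∈ (p : Set (LaurentRing d)) := by
    rw [hm]; exact Module.mem_annihilator.1 hf m
  exact this

/-- The minimal primes over the annihilator of a Noetherian module are associated primes. -/
theorem exists_mem_asc_le [IsNoetherian (LaurentRing d) M] {q : Ideal (LaurentRing d)}
    [hq : q.IsPrime] (h : Module.annihilator (LaurentRing d) M ≤ q) :
    ∃ p ∈ asc M, p ≤ q := by
  obtain ⟨p, hp, hpq⟩ := Ideal.exists_minimalPrimes_le h
  refine ⟨p, ?_, hpq⟩
  obtain ⟨hp', m, hm⟩ := isAssociatedPrime_iff.1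
    (Module.associatedPrimes.minimalPrimes_annihilator_subset_associatedPrimes _ M hp)
  refine ⟨hp', m, ?_⟩
  ext f
  rw [hm, SetLike.mem_coe, Submodule.mem_colon_singleton, Submodule.mem_bot]
  rfl

/-- If the annihilator misses the multiplicative set `oneSubStrict v`, some prime above it misses it
too; if it vanishes at z, the prime is the kernel of evaluation at z. An associated prime below
either prime inherits the failure. -/
theorem expansiveIdeal_annihilator_iff [IsNoetherian (LaurentRing d) M]
    (V : Submodule ℝ (Euc d)) :
    ExpansiveIdeal V (Module.annihilator (LaurentRing d) M) ↔
      ∀ p ∈ asc M, ExpansiveIdeal V p := by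
  refine ⟨fun h p hp => h.mono (annihilator_le_of_mem_asc hp), fun h => ⟨fun v hV hv => ?_, ?_⟩⟩
  · by_contra! hne
    obtain ⟨q, hq, hle, hdisj⟩ := Ideal.exists_le_prime_disjoint
      (Module.annihilator (LaurentRing d) M) (oneSubStrict v)
      (Set.disjoint_left.2 fun f hf hf' => hne f hf' hf)
    obtain ⟨p, hp, hpq⟩ := exists_mem_asc_le hle
    obtain ⟨f, hf, hfp⟩ := (h p hp).1 v hV hv
    exact Set.disjoint_left.1 hdisj (hpq hfp) hf
  · intro z hz
    have hle : Module.annihilator (LaurentRing d) M ≤ RingHom.ker (evalHom z) := fun f hf => by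
      rw [RingHom.mem_ker, evalHom_apply]; exact hz f hf
    have := RingHom.ker_isPrime (evalHom z)
    obtain ⟨p, hp, hpq⟩ := exists_mem_asc_le hle
    refine (h p hp).2 z fun f hf => ?_
    rw [← evalHom_apply]
    exact hpq hf

/-- A zero of the annihilator of a finitely generated module is an eigencharacter of a nonzero
complex-valued functional. -/
theorem exists_eigenfunctional [IsNoetherian (LaurentRing d) M] {z : Fin d → ℂˣ}
    (hz : z ∈ variety (Module.annihilator (LaurentRing d) M)) :
    ∃ φ : M →+ ℂ, φ ≠ 0 ∧ ∀ (f : LaurentRing d) (m : M), φ (f • m) = evalHom z f * φ m :=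
  exists_semilinear_functional (evalHom z) fun f hf => by
    rw [RingHom.mem_ker, evalHom_apply]; exact hz f hf

end Module

end Algebraic

/-! ### Characters of seminormed algebras -/

/-- The hypothesis keeps 1 away from 0 in the quotient seminorm, so the completion of A/I is a
nonzero commutative complex Banach algebra. It has a character, and characters are bounded. -/
theorem exists_character_vanishing {A : Type*} [SeminormedCommRing A] [NormedAlgebra ℂ A]
    (I : Ideal A) {η : ℝ} (hη : 0 < η) (hI : ∀ x ∈ I, η ≤ ‖1 - x‖) :
    ∃ χ : A →+* ℂ, (∀ x ∈ I, χ x = 0) ∧ ∃ C : ℝ, ∀ x, ‖χ x‖ ≤ C * ‖x‖ := by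
  have hone : η ≤ ‖(1 : A ⧸ I)‖ := by
    refine le_of_forall_pos_le_add fun ε hε => ?_
    obtain ⟨r, hr, hlt⟩ := Ideal.Quotient.norm_mk_lt (1 : A ⧸ I) hε
    have hmem : 1 - r ∈ I := Ideal.Quotient.eq.1 (by rw [hr, map_one])
    have := hI _ hmem
    rw [sub_sub_cancel] at this
    exact this.trans hlt.le
  have hnt : Nontrivial (UniformSpace.Completion (A ⧸ I)) := by
    refine ⟨⟨1, 0, fun h => ?_⟩⟩
    have h1 : ‖((1 : A ⧸ I) : UniformSpace.Completion (A ⧸ I))‖ = 0 := by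
      rw [UniformSpace.Completion.coe_one, h, norm_zero]
    rw [UniformSpace.Completion.norm_coe] at h1
    linarith
  obtain ⟨χ⟩ : Nonempty (WeakDual.characterSpace ℂ (UniformSpace.Completion (A ⧸ I))) :=
    inferInstance
  let ψ : UniformSpace.Completion (A ⧸ I) →ₐ[ℂ] ℂ := WeakDual.CharacterSpace.toAlgHom χ
  refine ⟨ψ.toRingHom.comp (UniformSpace.Completion.coeRingHom.comp (Ideal.Quotient.mk I)),
    fun x hx => ?_, ‖(1 : UniformSpace.Completion (A ⧸ I))‖, fun x => ?_⟩
  · rw [RingHom.comp_apply, RingHom.comp_apply, Ideal.Quotient.eq_zero_iff_mem.2 hx, map_zero,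
      map_zero]
  · refine (AlgHom.norm_apply_le_self_mul_norm_one ψ _).trans ?_
    rw [mul_comm]
    refine mul_le_mul_of_nonneg_left ?_ (norm_nonneg _)
    refine (UniformSpace.Completion.norm_coe (Ideal.Quotient.mk I x)).trans_le ?_
    exact Ideal.Quotient.norm_mk_le I x

/-! ### Weighted `ℓ¹`-norms on the complex group ring of `ℤ^d` -/

section Weighted

variable {d : ℕ}

/-- The weighted `ℓ¹`-norm `∑ |c_f(k)| w(k)`. -/
def weightedNorm (w : (Fin d → ℤ) → ℝ) (f : AddMonoidAlgebra ℂ (Fin d → ℤ)) : ℝ :=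
  f.coeff.sum fun k c => ‖c‖ * w k

variable {w : (Fin d → ℤ) → ℝ}

theorem weightedNorm_single (k : Fin d → ℤ) (c : ℂ) :
    weightedNorm w (AddMonoidAlgebra.single k c) = ‖c‖ * w k := by
  rw [weightedNorm, AddMonoidAlgebra.coeff_single, Finsupp.sum_single_index (by simp)]

theorem weightedNorm_zero : weightedNorm w 0 = 0 := by simp [weightedNorm]

theorem weightedNorm_add_le (hw : ∀ k, 0 ≤ w k) (f g : AddMonoidAlgebra ℂ (Fin d → ℤ)) :
    weightedNorm w (f + g) ≤ weightedNorm w f + weightedNorm w g := by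
  classical
  have hsub : ∀ h : AddMonoidAlgebra ℂ (Fin d → ℤ), ∀ s : Finset (Fin d → ℤ),
      h.coeff.support ⊆ s → weightedNorm w h = ∑ k ∈ s, ‖h.coeff k‖ * w k := fun h s hs =>
    Finsupp.sum_of_support_subset _ hs _ (by simp)
  rw [hsub (f + g) (f.coeff.support ∪ g.coeff.support) Finsupp.support_add,
    hsub f _ Finset.subset_union_left, hsub g _ Finset.subset_union_right,
    ← Finset.sum_add_distrib]
  refine Finset.sum_le_sum fun k _ => ?_
  rw [← add_mul]
  exact mul_le_mul_of_nonneg_right (norm_add_le _ _) (hw k)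

theorem weightedNorm_smul (c : ℂ) (f : AddMonoidAlgebra ℂ (Fin d → ℤ)) :
    weightedNorm w (c • f) = ‖c‖ * weightedNorm w f := by
  rw [weightedNorm, weightedNorm, AddMonoidAlgebra.coeff_smul,
    Finsupp.sum_of_support_subset _ (Finsupp.support_smul) _ (by simp), Finsupp.sum,
    Finset.mul_sum]
  refine Finset.sum_congr rfl fun k _ => ?_
  rw [Finsupp.smul_apply, norm_smul, mul_assoc]

theorem weightedNorm_neg (f : AddMonoidAlgebra ℂ (Fin d → ℤ)) :
    weightedNorm w (-f) = weightedNorm w f := by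
  rw [← neg_one_smul ℂ f, weightedNorm_smul, norm_neg, norm_one, one_mul]

theorem weightedNorm_sum_le (hw : ∀ k, 0 ≤ w k) {ι : Type*} (s : Finset ι)
    (f : ι → AddMonoidAlgebra ℂ (Fin d → ℤ)) :
    weightedNorm w (∑ i ∈ s, f i) ≤ ∑ i ∈ s, weightedNorm w (f i) :=
  Finset.le_sum_of_subadditive _ weightedNorm_zero.le (weightedNorm_add_le hw) _ _

theorem weightedNorm_mul_le (hw : ∀ k, 0 ≤ w k) (hmul : ∀ k l, w (k + l) ≤ w k * w l)
    (f g : AddMonoidAlgebra ℂ (Fin d → ℤ)) :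
    weightedNorm w (f * g) ≤ weightedNorm w f * weightedNorm w g := by
  rw [AddMonoidAlgebra.mul_def, Finsupp.sum]
  refine (weightedNorm_sum_le hw _ _).trans ?_
  rw [weightedNorm, weightedNorm, Finsupp.sum, Finset.sum_mul]
  refine Finset.sum_le_sum fun k _ => ?_
  rw [Finsupp.sum, Finsupp.sum, Finset.mul_sum]
  refine (weightedNorm_sum_le hw _ _).trans (Finset.sum_le_sum fun l _ => ?_)
  rw [weightedNorm_single, norm_mul, mul_mul_mul_comm]
  exact mul_le_mul_of_nonneg_left (hmul k l) (by positivity)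

/-- The complex group ring of `ℤ^d` with a weighted `ℓ¹`-norm. -/
abbrev weightedRing (hw : ∀ k, 0 ≤ w k) (hmul : ∀ k l, w (k + l) ≤ w k * w l) :
    SeminormedCommRing (AddMonoidAlgebra ℂ (Fin d → ℤ)) :=
  { AddGroupSeminorm.toSeminormedAddCommGroup
      { toFun := weightedNorm w
        map_zero' := weightedNorm_zero
        add_le' := weightedNorm_add_le hw
        neg' := weightedNorm_neg },
    (inferInstance : CommRing (AddMonoidAlgebra ℂ (Fin d → ℤ))) with
    norm_mul_le := weightedNorm_mul_le hw hmul }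

theorem exists_character_of_weightedNorm (hw : ∀ k, 0 ≤ w k)
    (hmul : ∀ k l, w (k + l) ≤ w k * w l) (I : Ideal (AddMonoidAlgebra ℂ (Fin d → ℤ)))
    {η : ℝ} (hη : 0 < η) (hI : ∀ h ∈ I, η ≤ weightedNorm w (1 - h)) :
    ∃ χ : AddMonoidAlgebra ℂ (Fin d → ℤ) →+* ℂ, (∀ h ∈ I, χ h = 0) ∧
      ∃ C : ℝ, ∀ h, ‖χ h‖ ≤ C * weightedNorm w h := by
  let := weightedRing hw hmul
  let : NormedAlgebra ℂ (AddMonoidAlgebra ℂ (Fin d → ℤ)) :=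
    { (inferInstance : Algebra ℂ (AddMonoidAlgebra ℂ (Fin d → ℤ))) with
      norm_smul_le := fun c f => (weightedNorm_smul c f).le }
  exact exists_character_vanishing I hη hI

/-- The coefficient inclusion `ℤ[ℤ^d] → ℂ[ℤ^d]`. -/
def complexify : LaurentRing d →+* AddMonoidAlgebra ℂ (Fin d → ℤ) :=
  AddMonoidAlgebra.mapRingHom _ (Int.castRingHom ℂ)

theorem complexify_monom (n : Fin d → ℤ) :
    complexify (monom n) = AddMonoidAlgebra.single n 1 := by
  simp [complexify, monom]

/-- Otherwise a bounded character kills the ideal. It is evaluation at a zero z of `a` with |z^n| ≤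
C exp(κ · dist(n, V)); this bounds n · log|z| along V, so log|z| is orthogonal to V. -/
theorem exists_weightedNorm_one_sub_lt {V : Submodule ℝ (Euc d)} {a : Ideal (LaurentRing d)}
    (ha : ∀ z ∈ variety a, logAbs z ∉ Vᗮ) {κ : ℝ} (hκ : 0 ≤ κ) {η : ℝ} (hη : 0 < η) :
    ∃ h ∈ a.map complexify,
      weightedNorm (fun k => Real.exp (κ * codist V k)) (1 - h) < η := by
  by_contra! hne
  obtain ⟨χ, hχ, C, hC⟩ := exists_character_of_weightedNorm
    (fun k => (Real.exp_pos (κ * codist V k)).le) (fun k l => by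
      rw [← Real.exp_add, ← mul_add]
      exact Real.exp_le_exp.2 (mul_le_mul_of_nonneg_left (codist_add_le V k l) hκ))
    (a.map complexify) hη hne
  obtain ⟨z, hz, hzn⟩ := exists_evalAt_eq (χ.comp complexify)
  refine ha z (fun f hf => ?_) ?_
  · rw [← hz, RingHom.comp_apply]
    exact hχ _ (Ideal.mem_map_of_mem _ hf)
  have hbound : ∀ n, Real.exp (inner ℝ (latticePoint n) (logAbs z))
      ≤ C * Real.exp (κ * codist V n) := by
    intro n
    rw [← norm_prod_zpow, ← hzn, RingHom.comp_apply, complexify_monom]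
    refine (hC _).trans_eq ?_
    rw [weightedNorm_single, norm_one, one_mul]
  have hCpos : 0 < C := by
    have h0 := hbound 0
    rw [latticePoint_zero, inner_zero_left, codist_zero, mul_zero, Real.exp_zero, mul_one] at h0
    linarith
  have hlin : ∀ n, inner ℝ (latticePoint n) (logAbs z) ≤ Real.log C + κ * codist V n := by
    intro n
    have := Real.log_le_log (Real.exp_pos _) (hbound n)
    rwa [Real.log_exp, Real.log_mul hCpos.ne' (Real.exp_pos _).ne', Real.log_exp] at this
  refine (Submodule.mem_orthogonal _ _).2 fun u hu => ?_
  obtain ⟨D, hD⟩ := exists_latticePoint_near d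
  -- A linear function bounded above on the whole line ℝu vanishes on it; lattice points within D of
  -- the line carry the bound over.
  have hline : ∀ r : ℝ, r * inner ℝ u (logAbs z)
      ≤ Real.log C + κ * D + D * ‖logAbs z‖ := by
    intro r
    obtain ⟨n, hn⟩ := hD (r • u)
    have h1 : codist V n ≤ D := (codist_le_of_mem V (V.smul_mem r hu) n).trans hn
    have h2 : inner ℝ (r • u - latticePoint n) (logAbs z) ≤ D * ‖logAbs z‖ := by
      refine (real_inner_le_norm _ _).trans (mul_le_mul_of_nonneg_right ?_ (norm_nonneg _))
      rwa [norm_sub_rev]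
    rw [inner_sub_left, real_inner_smul_left] at h2
    linarith [hlin n, mul_le_mul_of_nonneg_left h1 hκ]
  by_contra h0
  have := hline ((Real.log C + κ * D + D * ‖logAbs z‖ + 1) / inner ℝ u (logAbs z))
  rw [div_mul_cancel₀ _ h0] at this
  linarith

end Weighted

section Decrease

variable {d : ℕ}

/-! ### Pushing lattice points towards a subspace -/

/-- If the projection of n to Vᗮ has direction w close to v and length c, adding k changes the
squared length by at most -cδ + K², where K bounds the support. For large c the linear gain wins. -/
theorem exists_decrease_nhds {V : Submodule ℝ (Euc d)} {v : Euc d} {f : LaurentRing d}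
    (hf : f ∈ oneSubStrict v) : ∃ r > 0, ∃ t > 0, ∃ δ > 0, ∀ n : Fin d → ℤ, ∀ w ∈ Vᗮ,
      ‖w - v‖ < r → Vᗮ.starProjection (latticePoint n) = codist V n • w → ‖w‖ = 1 →
      t < codist V n → ∀ k ∈ (1 - f).coeff.support, codist V (n + k) ≤ codist V n - δ := by
  obtain ⟨δ, hδ, hle⟩ := StrictSupport.exists_le hf
  obtain ⟨K, hK1, hKle⟩ : ∃ K : ℝ, 1 ≤ K ∧ ∀ k ∈ (1 - f).coeff.support, ‖latticePoint k‖ ≤ K :=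
    ⟨1 + ∑ k ∈ (1 - f).coeff.support, ‖latticePoint k‖,
      le_add_of_nonneg_right (Finset.sum_nonneg fun _ _ => norm_nonneg _), fun k hk =>
      (Finset.single_le_sum (f := fun k => ‖latticePoint k‖)
        (fun _ _ => norm_nonneg _) hk).trans (le_add_of_nonneg_left zero_le_one)⟩
  -- The radius costs at most δ/2 in the inner product with w; the threshold gives K² ≤ cδ/2 and c >
  -- δ, whence c² - cδ + K² ≤ (c - δ/4)².
  refine ⟨δ / (2 * K), by positivity, 2 * K ^ 2 / δ + δ, by positivity, δ / 4, by positivity,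
    fun n w hwV hwv hn hw1 ht k hk => ?_⟩
  have h1 : inner ℝ (latticePoint k) w ≤ -(δ / 2) := by
    have h2 : inner ℝ (latticePoint k) (w - v) ≤ K * (δ / (2 * K)) :=
      (real_inner_le_norm _ _).trans (mul_le_mul (hKle k hk) hwv.le (norm_nonneg _) (zero_le_one.trans hK1))
    have h3 : K * (δ / (2 * K)) = δ / 2 := by field_simp
    rw [inner_sub_right] at h2
    linarith [hle k hk]
  have h8 : ‖Vᗮ.starProjection (latticePoint n)‖ = codist V n := rfl
  have hc00 := codist_nonneg V n
  generalize codist V n = c at *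
  have hcδ : K ^ 2 ≤ c * δ / 2 := by
    have h4 : 2 * K ^ 2 / δ ≤ c := by linarith
    rw [div_le_iff₀ hδ] at h4
    linarith
  have hc0 : δ < c := lt_of_le_of_lt (le_add_of_nonneg_left (by positivity)) ht
  have h5 : inner ℝ (Vᗮ.starProjection (latticePoint n)) (Vᗮ.starProjection (latticePoint k))
      ≤ c * -(δ / 2) := by
    rw [hn, real_inner_smul_left, real_inner_comm, ← inner_eq_inner_proj V hwV]
    exact mul_le_mul_of_nonneg_left h1 hc00
  have h6 : codist V (n + k) ^ 2 ≤ (c - δ / 4) ^ 2 := by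
    rw [codist, latticePoint_add, map_add, norm_add_sq_real]
    have h7 : ‖Vᗮ.starProjection (latticePoint k)‖ ^ 2 ≤ K ^ 2 :=
      pow_le_pow_left₀ (norm_nonneg _)
        ((Submodule.norm_starProjection_apply_le _ _).trans (hKle k hk)) 2
    rw [h8]
    nlinarith [sq_nonneg δ]
  exact le_of_sq_le_sq h6 (by linarith)

theorem exists_decrease {V : Submodule ℝ (Euc d)} {a : Ideal (LaurentRing d)}
    (h : ∀ v ∈ Vᗮ, ‖v‖ = 1 → ∃ f ∈ oneSubStrict v, f ∈ a) :
    ∃ G : Finset (LaurentRing d), ∃ t > 0, ∃ δ > 0, (∀ f ∈ G, f ∈ a) ∧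
      ∀ n, t < codist V n → ∃ f ∈ G, ∀ k ∈ (1 - f).coeff.support,
        codist V (n + k) ≤ codist V n - δ := by
  classical
  set S : Set (Euc d) := Metric.sphere 0 1 ∩ (Vᗮ : Set (Euc d)) with hS
  have hcomp : IsCompact S :=
    (isCompact_sphere 0 1).inter_right (Submodule.closed_of_finiteDimensional _)
  have hmemS : ∀ {w : Euc d}, w ∈ S ↔ ‖w‖ = 1 ∧ w ∈ Vᗮ := by simp [hS]
  -- The claim for directions in s only; it passes to subsets and finite unions, as compactness
  -- induction requires.
  let P : Set (Euc d) → Prop := fun s =>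
    ∃ G : Finset (LaurentRing d), ∃ t > 0, ∃ δ > 0, (∀ f ∈ G, f ∈ a) ∧
      ∀ n : Fin d → ℤ, ∀ w ∈ S, w ∈ s →
        Vᗮ.starProjection (latticePoint n) = codist V n • w → t < codist V n →
        ∃ f ∈ G, ∀ k ∈ (1 - f).coeff.support, codist V (n + k) ≤ codist V n - δ
  obtain ⟨G, t, ht, δ, hδ, hG, hP⟩ : P S := by
    refine hcomp.induction_on ?_ ?_ ?_ ?_
    · exact ⟨∅, 1, one_pos, 1, one_pos, by simp, fun _ _ _ h => h.elim⟩
    · rintro s s' hs ⟨G, t, ht, δ, hδ, hG, hP⟩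
      exact ⟨G, t, ht, δ, hδ, hG, fun n w hw hws => hP n w hw (hs hws)⟩
    · rintro s s' ⟨G, t, ht, δ, hδ, hG, hP⟩ ⟨G', t', ht', δ', hδ', hG', hP'⟩
      refine ⟨G ∪ G', max t t', lt_max_of_lt_left ht, min δ δ', lt_min hδ hδ', fun f hf => ?_,
        fun n w hw hws hn hlt => ?_⟩
      · exact (Finset.mem_union.1 hf).elim (hG f) (hG' f)
      · rcases hws with hws | hws
        · obtain ⟨f, hf, hk⟩ := hP n w hw hws hn ((le_max_left _ _).trans_lt hlt)
          exact ⟨f, Finset.mem_union_left _ hf, fun k hk' =>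
            (hk k hk').trans (sub_le_sub_left (min_le_left _ _) _)⟩
        · obtain ⟨f, hf, hk⟩ := hP' n w hw hws hn ((le_max_right _ _).trans_lt hlt)
          exact ⟨f, Finset.mem_union_right _ hf, fun k hk' =>
            (hk k hk').trans (sub_le_sub_left (min_le_right _ _) _)⟩
    · intro v hv
      obtain ⟨f, hf, hfa⟩ := h v (hmemS.1 hv).2 (hmemS.1 hv).1
      obtain ⟨r, hr, t, ht, δ, hδ, hdec⟩ := exists_decrease_nhds (V := V) hf
      refine ⟨Metric.ball v r, mem_nhdsWithin_of_mem_nhds (Metric.ball_mem_nhds v hr), {f}, t, ht,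
        δ, hδ, by simpa using hfa, fun n w hw hws hn hlt => ⟨f, by simp, ?_⟩⟩
      exact hdec n w (hmemS.1 hw).2 (by rwa [← dist_eq_norm]) hn (hmemS.1 hw).1 hlt
  refine ⟨G, t, ht, δ, hδ, hG, fun n hn => ?_⟩
  have hpos : 0 < codist V n := ht.trans hn
  have hmem : (codist V n)⁻¹ • Vᗮ.starProjection (latticePoint n) ∈ S := by
    refine hmemS.2 ⟨?_, Submodule.smul_mem _ _ (Submodule.starProjection_apply_mem _ _)⟩
    rw [norm_smul, norm_inv, Real.norm_of_nonneg hpos.le]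
    exact inv_mul_cancel₀ hpos.ne'
  refine hP n _ hmem hmem ?_ hn
  rw [smul_smul, mul_inv_cancel₀ hpos.ne', one_smul]

end Decrease

section SmallCharacters

variable {d : ℕ}

/-! ### Small characters of cyclic modules -/

/-- The pairing `∑ c_h(k) y(n + k)`. -/
def pairing (y : (Fin d → ℤ) → ℝ) (n : Fin d → ℤ) :
    AddMonoidAlgebra ℂ (Fin d → ℤ) →ₗ[ℂ] ℂ :=
  (Finsupp.linearCombination ℂ fun k => (y (n + k) : ℂ)).comp
    (AddMonoidAlgebra.coeffLinearEquiv ℂ).toLinearMap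

variable {y : (Fin d → ℤ) → ℝ}

theorem pairing_apply (n : Fin d → ℤ) (h : AddMonoidAlgebra ℂ (Fin d → ℤ)) :
    pairing y n h = ∑ k ∈ h.coeff.support, h.coeff k * (y (n + k) : ℂ) := rfl

theorem pairing_single (n k : Fin d → ℤ) (c : ℂ) :
    pairing y n (AddMonoidAlgebra.single k c) = c * (y (n + k) : ℂ) := by
  change Finsupp.linearCombination ℂ _ (Finsupp.single k c) = _
  rw [Finsupp.linearCombination_single, smul_eq_mul]

theorem pairing_one (n : Fin d → ℤ) : pairing y n 1 = y n := by
  rw [AddMonoidAlgebra.one_def, pairing_single, one_mul, add_zero]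

theorem pairing_single_mul (n m : Fin d → ℤ) (c : ℂ) (h : AddMonoidAlgebra ℂ (Fin d → ℤ)) :
    pairing y n (AddMonoidAlgebra.single m c * h) = c * pairing y (n + m) h := by
  induction h using AddMonoidAlgebra.induction_linear with
  | zero => simp
  | add f g hf hg => rw [mul_add, map_add, map_add, hf, hg, mul_add]
  | single k b =>
    rw [AddMonoidAlgebra.single_mul_single, pairing_single, pairing_single, mul_assoc, add_assoc]

theorem norm_pairing_le (n : Fin d → ℤ) (h : AddMonoidAlgebra ℂ (Fin d → ℤ)) :
    ‖pairing y n h‖ ≤ ∑ k ∈ h.coeff.support, ‖h.coeff k‖ * |y (n + k)| := by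
  rw [pairing_apply]
  refine (norm_sum_le _ _).trans_eq (Finset.sum_congr rfl fun k _ => ?_)
  rw [norm_mul, Complex.norm_real, Real.norm_eq_abs]

theorem pairing_complexify (n : Fin d → ℤ) (f : LaurentRing d) :
    pairing y n (complexify f) = ((∑ k ∈ f.coeff.support, f.coeff k * y (n + k) : ℝ) : ℂ) := by
  conv_lhs => rw [laurent_eq_sum f, map_sum, map_sum]
  push_cast
  refine Finset.sum_congr rfl fun k _ => ?_
  rw [map_zsmul, map_zsmul, complexify_monom, pairing_single, one_mul, zsmul_eq_mul]

/-- The angles of the values of a character at the monomials. -/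
def angle (χ : AddChar (LaurentRing d) Circle) (n : Fin d → ℤ) : ℝ :=
  Complex.arg (χ (monom n))

theorem exp_angle (χ : AddChar (LaurentRing d) Circle) (n : Fin d → ℤ) :
    Circle.exp (angle χ n) = χ (monom n) := Circle.exp_arg _

theorem addChar_map_sum {A N ι : Type*} [AddCommMonoid A] [CommMonoid N]
    (χ : AddChar A N) (s : Finset ι) (f : ι → A) : χ (∑ i ∈ s, f i) = ∏ i ∈ s, χ (f i) := by
  classical
  induction s using Finset.induction_on with
  | empty => simp
  | insert i s hi ih => rw [Finset.sum_insert hi, Finset.prod_insert hi, AddChar.map_add_eq_mul, ih]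

theorem circle_exp_sum {ι : Type*} (s : Finset ι) (f : ι → ℝ) :
    Circle.exp (∑ i ∈ s, f i) = ∏ i ∈ s, Circle.exp (f i) := by
  classical
  induction s using Finset.induction_on with
  | empty => simp
  | insert i s hi ih => rw [Finset.sum_insert hi, Finset.prod_insert hi, Circle.exp_add, ih]

theorem map_monom_mul (χ : AddChar (LaurentRing d) Circle) (n : Fin d → ℤ) (f : LaurentRing d) :
    χ (monom n * f) = ∏ k ∈ f.coeff.support, χ (monom (n + k)) ^ f.coeff k := by
  conv_lhs => rw [laurent_eq_sum f]
  rw [Finset.mul_sum, addChar_map_sum]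
  refine Finset.prod_congr rfl fun k _ => ?_
  rw [mul_smul_comm, ← monom_add, AddChar.map_zsmul_eq_zpow]

/-- The `ℓ¹`-norm of a Laurent polynomial. -/
def l1Norm (f : LaurentRing d) : ℝ := ∑ k ∈ f.coeff.support, |(f.coeff k : ℝ)|

theorem l1Norm_nonneg (f : LaurentRing d) : 0 ≤ l1Norm f :=
  Finset.sum_nonneg fun _ _ => abs_nonneg _

/-- The relation makes the sum of angles a multiple of 2π; smallness bounds it by 1, so it is zero.
-/
theorem pairing_angle_eq_zero {χ : AddChar (LaurentRing d) Circle} {f : LaurentRing d}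
    {n : Fin d → ℤ} {ε : ℝ} (hχ : χ (monom n * f) = 1)
    (hsmall : ∀ k ∈ f.coeff.support, |angle χ (n + k)| ≤ ε) (hε : ε * l1Norm f ≤ 1) :
    pairing (angle χ) n (complexify f) = 0 := by
  rw [pairing_complexify]
  set r : ℝ := ∑ k ∈ f.coeff.support, f.coeff k * angle χ (n + k) with hr
  have h1 : Circle.exp r = 1 := by
    rw [← hχ, map_monom_mul, hr, circle_exp_sum]
    refine Finset.prod_congr rfl fun k _ => ?_
    rw [← exp_angle, ← Circle.exp_zsmul, zsmul_eq_mul]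
  have h2 : |r| ≤ 1 := by
    refine (Finset.abs_sum_le_sum_abs _ _).trans (le_trans ?_ hε)
    rw [l1Norm, Finset.mul_sum]
    refine Finset.sum_le_sum fun k hk => ?_
    rw [abs_mul, mul_comm]
    exact mul_le_mul_of_nonneg_right (hsmall k hk) (abs_nonneg _)
  obtain ⟨m, hm⟩ := Circle.exp_eq_one.1 h1
  have h3 : m = 0 := by
    by_contra hm0
    have h4 : (1 : ℝ) ≤ |(m : ℝ)| := by exact_mod_cast Int.one_le_abs hm0
    rw [hm, abs_mul, abs_of_pos Real.two_pi_pos] at h2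
    nlinarith [Real.pi_gt_three]
  rw [hm, h3]; simp

/-- The characters of `R_d / 𝔞` that are small along the `T`-neighbourhood of `V`. -/
def IsSmall (V : Submodule ℝ (Euc d)) (a : Ideal (LaurentRing d)) (T ε : ℝ)
    (χ : AddChar (LaurentRing d) Circle) : Prop :=
  (∀ f ∈ a, χ f = 1) ∧ ∀ n, codist V n ≤ T → |angle χ n| ≤ ε

variable {V : Submodule ℝ (Euc d)} {a : Ideal (LaurentRing d)}

theorem IsSmall.mono {T T' ε ε' : ℝ} {χ : AddChar (LaurentRing d) Circle}
    (h : IsSmall V a T ε χ) (hT : T' ≤ T) (hε : ε ≤ ε') : IsSmall V a T' ε' χ :=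
  ⟨h.1, fun n hn => (h.2 n (hn.trans hT)).trans hε⟩

/-- Elements of the extended ideal are finite ℂ-combinations of monomial multiples of elements of
`a`. Multiplying by u^m translates the pairing by m, which only asks for a wider strip; hence t
varies in the induction. -/
theorem exists_pairing_eq_zero {h : AddMonoidAlgebra ℂ (Fin d → ℤ)}
    (hh : h ∈ a.map complexify) (t : ℝ) : ∃ T, ∃ ε > 0, ∀ χ, IsSmall V a T ε χ →
      ∀ n, codist V n ≤ t → pairing (angle χ) n h = 0 := by
  rw [Ideal.map] at hh
  induction hh using Submodule.span_induction generalizing t with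
  | mem x hx =>
    obtain ⟨f, hf, rfl⟩ := hx
    refine ⟨t + ∑ k ∈ f.coeff.support, codist V k, 1 / (l1Norm f + 1),
      by have := l1Norm_nonneg f; positivity, fun χ hχ n hn => ?_⟩
    refine pairing_angle_eq_zero (hχ.1 _ (a.mul_mem_left _ hf)) (fun k hk => hχ.2 _ ?_) ?_
    · exact (codist_add_le V n k).trans (add_le_add hn (Finset.single_le_sum
        (f := fun k => codist V k) (fun _ _ => codist_nonneg V _) hk))
    · have := l1Norm_nonneg f
      rw [div_mul_eq_mul_div, one_mul, div_le_one (by linarith)]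
      linarith
  | zero => exact ⟨0, 1, one_pos, fun χ _ n _ => map_zero _⟩
  | add x y _ _ hx hy =>
    obtain ⟨T, ε, hε, h⟩ := hx t
    obtain ⟨T', ε', hε', h'⟩ := hy t
    refine ⟨max T T', min ε ε', lt_min hε hε', fun χ hχ n hn => ?_⟩
    rw [map_add, h χ (hχ.mono (le_max_left _ _) (min_le_left _ _)) n hn,
      h' χ (hχ.mono (le_max_right _ _) (min_le_right _ _)) n hn, add_zero]
  | smul c x _ hx =>
    rw [smul_eq_mul]
    induction c using AddMonoidAlgebra.induction_linear with
    | zero => exact ⟨0, 1, one_pos, fun χ _ n _ => by rw [zero_mul, map_zero]⟩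
    | add f g hf hg =>
      obtain ⟨T, ε, hε, h⟩ := hf
      obtain ⟨T', ε', hε', h'⟩ := hg
      refine ⟨max T T', min ε ε', lt_min hε hε', fun χ hχ n hn => ?_⟩
      rw [add_mul, map_add, h χ (hχ.mono (le_max_left _ _) (min_le_left _ _)) n hn,
        h' χ (hχ.mono (le_max_right _ _) (min_le_right _ _)) n hn, add_zero]
    | single m b =>
      obtain ⟨T, ε, hε, h⟩ := hx (t + codist V m)
      refine ⟨T, ε, hε, fun χ hχ n hn => ?_⟩
      rw [pairing_single_mul, h χ hχ _ ((codist_add_le V n m).trans (by linarith)), mul_zero]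

theorem coeff_support_of_one_sub {f : LaurentRing d} {k : Fin d → ℤ}
    (hk : k ∈ f.coeff.support) : k = 0 ∨ k ∈ (1 - f).coeff.support := by
  have h : f = 1 + -(1 - f) := by ring
  rw [h] at hk
  rcases coeff_support_add hk with h1 | h1
  · rw [← monom_zero] at h1
    exact Or.inl (coeff_support_monom 0 h1)
  · rw [AddMonoidAlgebra.coeff_neg, Finsupp.support_neg] at h1
    exact Or.inr h1

/-- Induction towards a subspace. -/
theorem induction_codist {G : Finset (LaurentRing d)} {t δ : ℝ} (hδ : 0 < δ)
    (hG : ∀ n, t < codist V n → ∃ f ∈ G, ∀ k ∈ (1 - f).coeff.support,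
        codist V (n + k) ≤ codist V n - δ) {P : (Fin d → ℤ) → Prop}
    (base : ∀ n, codist V n ≤ t → P n)
    (step : ∀ n, ∀ f ∈ G, t < codist V n → (∀ k ∈ (1 - f).coeff.support,
      codist V (n + k) ≤ codist V n - δ ∧ P (n + k)) → P n) (n : Fin d → ℤ) : P n := by
  -- Each step lowers the distance by at least δ, so ordinary induction on the number of δ-layers
  -- suffices.
  have key : ∀ N : ℕ, ∀ n, codist V n < N * δ → P n := by
    intro N
    induction N with
    | zero =>
      intro n hn
      have := codist_nonneg V n
      simp only [Nat.cast_zero, zero_mul] at hn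
      linarith
    | succ N ih =>
      intro n hn
      rcases le_or_gt (codist V n) t with h | h
      · exact base n h
      · obtain ⟨f, hf, hk⟩ := hG n h
        refine step n f hf h fun k hk' => ⟨hk k hk', ih _ ?_⟩
        push_cast at hn
        linarith [hk k hk']
  obtain ⟨N, hN⟩ := exists_nat_gt (codist V n / δ)
  exact key N n ((div_lt_iff₀ hδ).1 hN)

theorem eq_one_of_isSmall (ha : ExpansiveIdeal V a) :
    ∃ T, ∃ ε > 0, ∀ χ, IsSmall V a T ε χ → χ = 1 := by
  obtain ⟨G, t, ht, δ, hδ, hGa, hG⟩ := exists_decrease ha.1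
  obtain ⟨C, hC1, hC⟩ : ∃ C : ℝ, 1 ≤ C ∧ ∀ f ∈ G, l1Norm f ≤ C ∧ l1Norm (1 - f) ≤ C := by
    refine ⟨1 + ∑ f ∈ G, (l1Norm f + l1Norm (1 - f)), le_add_of_nonneg_right
      (Finset.sum_nonneg fun f _ => add_nonneg (l1Norm_nonneg f) (l1Norm_nonneg _)),
      fun f hf => ?_⟩
    have := Finset.single_le_sum (f := fun f => l1Norm f + l1Norm (1 - f))
      (fun f _ => add_nonneg (l1Norm_nonneg f) (l1Norm_nonneg _)) hf
    have h1 := l1Norm_nonneg f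
    have h2 := l1Norm_nonneg (1 - f)
    constructor <;> linarith
  have hC0 : 0 < C := one_pos.trans_le hC1
  -- One step through a relation multiplies bounds by at most C while the distance changes by at
  -- least δ; κ is the matching exponential rate.
  obtain ⟨κ, hκ, hκC⟩ : ∃ κ : ℝ, 0 ≤ κ ∧ Real.exp (κ * δ) = C :=
    ⟨Real.log C / δ, div_nonneg (Real.log_nonneg hC1) hδ.le, by
      rw [div_mul_cancel₀ _ hδ.ne', Real.exp_log hC0]⟩
  -- The factor exp(-κt) cancels the growth allowed inside the strip of width t, leaving a
  -- contraction by 1/2.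
  obtain ⟨h, hh, hnorm⟩ := exists_weightedNorm_one_sub_lt ha.2 hκ
    (η := Real.exp (-(κ * t)) / 2) (by positivity)
  obtain ⟨T, ε, hε, hpair⟩ := exists_pairing_eq_zero (V := V) hh t
  set T' := max T (t + ∑ k ∈ (1 - h).coeff.support, codist V k) with hT'
  refine ⟨T', min ε (1 / C), lt_min hε (by positivity), fun χ hχ => ?_⟩
  -- values far from the subspace are controlled by values close to it
  have growth : ∀ B : ℝ, (∀ n, codist V n ≤ t → |angle χ n| ≤ B) →
      ∀ n, codist V n ≤ T' → |angle χ n| ≤ B * Real.exp (κ * codist V n) := by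
    intro B hB
    have hB0 : 0 ≤ B := (abs_nonneg _).trans (hB 0 (by rw [codist_zero]; exact ht.le))
    refine induction_codist hδ hG (fun n hn _ => ?_) (fun n f hf hn hk hnT => ?_)
    · exact (hB n hn).trans (le_mul_of_one_le_right hB0
        (Real.one_le_exp (mul_nonneg hκ (codist_nonneg V n))))
    · have hzero : pairing (angle χ) n (complexify f) = 0 := by
        refine pairing_angle_eq_zero (ε := 1 / C) (hχ.1 _ (a.mul_mem_left _ (hGa f hf)))
          (fun k hkf => ?_) ?_
        · refine (hχ.2 _ ?_).trans (min_le_right _ _)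
          rcases coeff_support_of_one_sub hkf with rfl | hk'
          · rwa [add_zero]
          · linarith [(hk k hk').1]
        · rw [div_mul_eq_mul_div, one_mul, div_le_one hC0]
          exact (hC f hf).1
      have heq : ((∑ k ∈ (1 - f).coeff.support, (1 - f).coeff k * angle χ (n + k) : ℝ) : ℂ)
          = (angle χ n : ℂ) := by
        rw [← pairing_complexify, map_sub, map_sub, hzero, sub_zero, map_one, pairing_one]
      rw [← Complex.ofReal_injective heq]
      refine (Finset.abs_sum_le_sum_abs _ _).trans ?_
      have hterm : ∀ k ∈ (1 - f).coeff.support, |(1 - f).coeff k * angle χ (n + k)|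
          ≤ |((1 - f).coeff k : ℝ)| * (B * Real.exp (κ * (codist V n - δ))) := by
        intro k hk'
        rw [abs_mul]
        refine mul_le_mul_of_nonneg_left ?_ (abs_nonneg _)
        refine ((hk k hk').2 (by linarith [(hk k hk').1])).trans ?_
        exact mul_le_mul_of_nonneg_left (Real.exp_le_exp.2
          (mul_le_mul_of_nonneg_left (hk k hk').1 hκ)) hB0
      refine (Finset.sum_le_sum hterm).trans ?_
      rw [← Finset.sum_mul, mul_sub, Real.exp_sub, hκC]
      have h1 : l1Norm (1 - f) * (B * (Real.exp (κ * codist V n) / C))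
          ≤ C * (B * (Real.exp (κ * codist V n) / C)) :=
        mul_le_mul_of_nonneg_right (hC f hf).2 (by positivity)
      refine h1.trans_eq ?_
      field_simp
  -- Since h pairs to zero, the angle at n is the pairing with 1 - h, whose terms are controlled by
  -- `growth`.
  have halve : ∀ B : ℝ, (∀ n, codist V n ≤ t → |angle χ n| ≤ B) →
      ∀ n, codist V n ≤ t → |angle χ n| ≤ B / 2 := by
    intro B hB n hn
    have hB0 : 0 ≤ B := (abs_nonneg _).trans (hB 0 (by rw [codist_zero]; exact ht.le))
    have h0 := hpair χ (hχ.mono (le_max_left _ _) (min_le_left _ _)) n hn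
    have h1 : pairing (angle χ) n (1 - h) = angle χ n := by
      rw [map_sub, h0, sub_zero, pairing_one]
    have h2 : |angle χ n| = ‖pairing (angle χ) n (1 - h)‖ := by
      rw [h1, Complex.norm_real, Real.norm_eq_abs]
    rw [h2]
    refine (norm_pairing_le _ _).trans ?_
    have hterm : ∀ k ∈ (1 - h).coeff.support, ‖(1 - h).coeff k‖ * |angle χ (n + k)|
        ≤ (‖(1 - h).coeff k‖ * Real.exp (κ * codist V k)) * (B * Real.exp (κ * t)) := by
      intro k hk
      rw [mul_assoc]
      refine mul_le_mul_of_nonneg_left ?_ (norm_nonneg _)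
      have h3 : codist V (n + k) ≤ t + codist V k :=
        (codist_add_le V n k).trans (add_le_add_left hn _)
      refine (growth B hB (n + k) (le_max_of_le_right (h3.trans (add_le_add_right ?_ _)))).trans ?_
      · exact Finset.single_le_sum (f := fun k => codist V k) (fun _ _ => codist_nonneg V _) hk
      · rw [mul_left_comm, ← Real.exp_add, ← mul_add, add_comm (codist V k)]
        exact mul_le_mul_of_nonneg_left (Real.exp_le_exp.2 (mul_le_mul_of_nonneg_left h3 hκ)) hB0
    refine (Finset.sum_le_sum hterm).trans ?_
    rw [← Finset.sum_mul]
    have h4 := mul_le_mul_of_nonneg_right hnorm.le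
      (mul_nonneg hB0 (Real.exp_pos (κ * t)).le)
    refine h4.trans_eq ?_
    rw [Real.exp_neg]
    field_simp
  have hzero : ∀ n, codist V n ≤ t → angle χ n = 0 := by
    have hpow : ∀ j : ℕ, ∀ n, codist V n ≤ t → |angle χ n| ≤ (min ε (1 / C)) * (1 / 2) ^ j := by
      intro j
      induction j with
      | zero =>
        intro n hn
        rw [pow_zero, mul_one]
        refine hχ.2 n (hn.trans (le_max_of_le_right (le_add_of_nonneg_right ?_)))
        exact Finset.sum_nonneg fun _ _ => codist_nonneg V _
      | succ j ih =>
        intro n hn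
        refine (halve _ ih n hn).trans_eq ?_
        rw [pow_succ]; ring
    intro n hn
    have hlim : Filter.Tendsto (fun j : ℕ => (min ε (1 / C)) * (1 / 2 : ℝ) ^ j) Filter.atTop
        (nhds 0) := by
      simpa using (tendsto_pow_atTop_nhds_zero_of_lt_one (r := (1 / 2 : ℝ)) (by norm_num)
        (by norm_num)).const_mul (min ε (1 / C))
    exact abs_nonpos_iff.1 (ge_of_tendsto' hlim fun j => hpow j n hn)
  -- Here the multiplicative relation itself is used, so no smallness is needed and all n are
  -- reached.
  have hone : ∀ n, χ (monom n) = 1 := by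
    refine induction_codist hδ hG (fun n hn => ?_) (fun n f hf _ hk => ?_)
    · rw [← exp_angle, hzero n hn, Circle.exp_zero]
    · have h1 : monom n = monom n * f + monom n * (1 - f) := by ring
      rw [h1, AddChar.map_add_eq_mul, hχ.1 _ (a.mul_mem_left _ (hGa f hf)), one_mul,
        map_monom_mul]
      exact Finset.prod_eq_one fun k hk' => by rw [(hk k hk').2, one_zpow]
  refine AddChar.eq_one_iff.2 fun f => ?_
  have h1 := map_monom_mul χ 0 f
  rw [monom_zero, one_mul] at h1
  rw [h1]
  exact Finset.prod_eq_one fun k _ => by rw [hone, one_zpow]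

end SmallCharacters

section Topological

open Topology

/-! ### Neighbourhoods in the dual group -/

theorem exists_edist_le_imp_arg_le {X : Type*} [TopologicalSpace X] [CompactSpace X]
    (ρ : CompatibleMetric X) {F : X → Circle} (hF : Continuous F) {ε₀ : ℝ} (hε₀ : 0 < ε₀) :
    ∃ ε > (0 : ℝ), ∀ x y, ρ.1.edist x y ≤ ENNReal.ofReal ε →
      |Complex.arg (F x / F y : Circle)| ≤ ε₀ := by
  obtain ⟨m, rfl⟩ := ρ
  have hcont : ContinuousAt (fun z : Circle => Complex.arg z) 1 :=
    (Complex.continuousAt_arg (by simp)).comp (by fun_prop : Continuous fun z : Circle => (z : ℂ)).continuousAt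
  obtain ⟨δ, hδ, hδ'⟩ := Metric.continuousAt_iff.1 hcont ε₀ hε₀
  have hG : UniformContinuous fun q : X × X => F q.1 / F q.2 :=
    CompactSpace.uniformContinuous_of_continuous (by fun_prop)
  obtain ⟨ε, hε, hε'⟩ := Metric.uniformContinuous_iff.1 hG δ hδ
  refine ⟨ε / 2, half_pos hε, fun x y hxy => ?_⟩
  have hd : dist x y ≤ ε / 2 := by
    replace hxy : edist x y ≤ ENNReal.ofReal (ε / 2) := hxy
    rw [edist_dist] at hxy
    exact (ENNReal.ofReal_le_ofReal_iff (half_pos hε).le).1 hxy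
  have h1 : dist (F x / F y) (F y / F y) < δ := by
    refine hε' (a := (x, y)) (b := (y, y)) ?_
    rw [Prod.dist_eq, dist_self, max_eq_left dist_nonneg]
    linarith
  rw [div_self'] at h1
  have h2 := hδ' h1
  rw [Circle.coe_one, Complex.arg_one, Real.dist_eq, sub_zero] at h2
  exact h2.le

theorem CompatibleMetric.closedBall_mem_nhds {X : Type*} [TopologicalSpace X]
    (ρ : CompatibleMetric X) (y : X) {ε : ℝ} (hε : 0 < ε) :
    {x | ρ.1.edist x y ≤ ENNReal.ofReal ε} ∈ 𝓝 y := by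
  obtain ⟨m, rfl⟩ := ρ
  exact Metric.closedEBall_mem_nhds y (ENNReal.ofReal_pos.2 hε)

section Dual

variable {M : Type*} [AddCommGroup M]

theorem continuous_dual_apply (m : DiscreteMul M) :
    Continuous fun x : DualGroup M => x m :=
  (continuous_eval_const (F := C(DiscreteMul M, Circle)) m).comp
    (ContinuousMonoidHom.isEmbedding_toContinuousMap (DiscreteMul M) Circle).continuous

/-- A character of the abelian group `M`, as an element of the dual group. -/
def dualOf (c : M →+ Additive Circle) : DualGroup M :=
  (⟨AddMonoidHom.toMultiplicativeLeft c, continuous_of_discreteTopology⟩ :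
    DiscreteMul M →ₜ* Circle)

/-- The value of a character at an element of the abelian group `M`. -/
def evalDual (x : DualGroup M) (m : M) : Circle := x (Multiplicative.ofAdd m : Multiplicative M)

theorem evalDual_dualOf (c : M →+ Additive Circle) (m : M) :
    evalDual (dualOf c) m = (c m).toMul := rfl

theorem evalDual_add (x : DualGroup M) (m m' : M) :
    evalDual x (m + m') = evalDual x m * evalDual x m' := map_mul x _ _

theorem evalDual_zero (x : DualGroup M) : evalDual x (0 : M) = 1 := map_one x

theorem evalDual_ext {x y : DualGroup M} (h : ∀ m, evalDual x m = evalDual y m) : x = y :=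
  PontryaginDual.ext h

theorem dualAction_one {d : ℕ} [Module (LaurentRing d) M] (n : Fin d → ℤ) :
    dualAction M (Multiplicative.ofAdd n) (1 : DualGroup M) = 1 := rfl

/-- Evaluation embeds the compact dual as a closed subspace of a product of circles, so its topology
is that of pointwise convergence. -/
theorem exists_finset_evalDual_mem {W : Set (DualGroup M)} (hW : W ∈ 𝓝 (1 : DualGroup M)) :
    ∃ S : Finset M, ∃ U ∈ 𝓝 (1 : Circle), ∀ x : DualGroup M,
      (∀ s ∈ S, evalDual x s ∈ U) → x ∈ W := by
  have hemb : IsClosedEmbedding fun (x : DualGroup M) (m : M) => evalDual x m :=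
    Continuous.isClosedEmbedding (continuous_pi fun m => continuous_dual_apply _)
      fun x y h => evalDual_ext (congrFun h)
  rw [hemb.isInducing.nhds_eq_comap, nhds_pi] at hW
  obtain ⟨s, hs, hsW⟩ := hW
  obtain ⟨I, hI, t, ht, hts⟩ := Filter.mem_pi.1 hs
  refine ⟨hI.toFinset, ⋂ i ∈ I, t i, (Filter.biInter_mem hI).2 fun i _ => ht i, fun x hx => ?_⟩
  refine hsW (hts fun i hi => ?_)
  exact Set.mem_iInter₂.1 (hx i (hI.mem_toFinset.2 hi)) i hi

/-- Characters into ℚ/ℤ separate points, and q ↦ exp(2πiq) embeds ℚ/ℤ into the circle. -/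
theorem exists_circle_character {A : Type*} [AddCommGroup A] {a : A} (ha : a ≠ 0) :
    ∃ c : A →+ Additive Circle, c a ≠ 0 := by
  obtain ⟨c, hc⟩ := CharacterModule.exists_character_apply_ne_zero_of_ne_zero ha
  let e : ℚ →+ Additive Circle :=
    { toFun := fun q => Additive.ofMul (Circle.exp (q * (2 * Real.pi)))
      map_zero' := by simp
      map_add' := fun q r => by
        rw [← ofMul_mul, ← Circle.exp_add]; push_cast; rw [add_mul] }
  have he : ∀ q, e q = 0 ↔ q ∈ AddSubgroup.zmultiples (1 : ℚ) := by
    intro q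
    rw [AddSubgroup.mem_zmultiples_iff]
    change Circle.exp (q * (2 * Real.pi)) = 1 ↔ _
    rw [Circle.exp_eq_one]
    refine exists_congr fun n => ?_
    rw [mul_left_inj' Real.two_pi_pos.ne', zsmul_eq_mul, mul_one, eq_comm]
    norm_cast
  refine ⟨(QuotientAddGroup.lift (AddSubgroup.zmultiples (1 : ℚ)) e
    fun q hq => (he q).2 hq).comp c, fun h => hc ?_⟩
  obtain ⟨q, hq⟩ := QuotientAddGroup.mk_surjective (s := AddSubgroup.zmultiples (1 : ℚ)) (c a)
  replace h : QuotientAddGroup.lift (AddSubgroup.zmultiples (1 : ℚ)) e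
    (fun q hq => (he q).2 hq) (c a) = 0 := h
  rw [← hq] at h
  rw [← hq]
  exact (QuotientAddGroup.eq_zero_iff q).2 ((he q).1 h)

end Dual

/-! ### Expansiveness and the annihilator -/

section Main

variable {d : ℕ} {M : Type*} [AddCommGroup M] [Module (LaurentRing d) M]
  {V : Submodule ℝ (Euc d)}

theorem distAlong_le_iff {X : Type*} [TopologicalSpace X] (ρ : CompatibleMetric X)
    (β : Multiplicative (Fin d → ℤ) →* (X ≃ₜ X)) {t : ℝ} (ht : 0 ≤ t) (x y : X)
    (c : ENNReal) : distAlong ρ β (Metric.cthickening t (V : Set (Euc d))) x y ≤ c ↔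
      ∀ n, codist V n ≤ t →
        ρ.1.edist (β (Multiplicative.ofAdd n) x) (β (Multiplicative.ofAdd n) y) ≤ c := by
  simp only [distAlong, iSup_le_iff, mem_cthickening_iff V ht]
  rfl

theorem ExpansiveIdeal.expansiveAlong [IsNoetherian (LaurentRing d) M]
    (h : ExpansiveIdeal V (Module.annihilator (LaurentRing d) M))
    (ρ : CompatibleMetric (DualGroup M)) : ExpansiveAlong ρ (dualAction (d := d) M) V := by
  obtain ⟨T, ε₀, hε₀, hone⟩ := eq_one_of_isSmall h
  obtain ⟨S, hS⟩ := (IsNoetherian.noetherian (⊤ : Submodule (LaurentRing d) M))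
  obtain ⟨ε, hε, hρ⟩ : ∃ ε > (0 : ℝ), ∀ s ∈ S, ∀ x y : DualGroup M,
      ρ.1.edist x y ≤ ENNReal.ofReal ε →
      |Complex.arg (evalDual x s / evalDual y s : Circle)| ≤ ε₀ := by
    classical
    clear hS
    induction S using Finset.induction_on with
    | empty => exact ⟨1, one_pos, by simp⟩
    | insert s S _ ih =>
      obtain ⟨ε, hε, hρ⟩ := ih
      obtain ⟨ε', hε', hρ'⟩ := exists_edist_le_imp_arg_le ρ
        (continuous_dual_apply (Multiplicative.ofAdd s : Multiplicative M)) hε₀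
      refine ⟨min ε ε', lt_min hε hε', fun s' hs' x y hxy => ?_⟩
      rcases Finset.mem_insert.1 hs' with rfl | hs'
      · exact hρ' x y (hxy.trans (ENNReal.ofReal_le_ofReal (min_le_right _ _)))
      · exact hρ s' hs' x y (hxy.trans (ENNReal.ofReal_le_ofReal (min_le_left _ _)))
  refine ⟨ε, hε, max T 1, lt_max_of_lt_right one_pos, fun x y hxy => evalDual_ext fun m => ?_⟩
  rw [distAlong_le_iff _ _ (le_max_of_le_right zero_le_one)] at hxy
  have hchar : ∀ s ∈ S, ∀ f : LaurentRing d, evalDual x (f • s) = evalDual y (f • s) := by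
    intro s hs f
    -- Comparing x and y on the cyclic submodule of one generator reduces the claim to small
    -- characters of R_d trivial on the annihilator.
    let χ : AddChar (LaurentRing d) Circle :=
      { toFun := fun f => evalDual x (f • s) / evalDual y (f • s)
        map_zero_eq_one' := by rw [zero_smul, evalDual_zero, evalDual_zero, div_one]
        map_add_eq_mul' := fun f g => by
          rw [add_smul, evalDual_add, evalDual_add, mul_div_mul_comm] }
    have hχ : χ = 1 := by
      refine hone χ ⟨fun f hf => ?_, fun n hn => ?_⟩
      · change evalDual x (f • s) / evalDual y (f • s) = 1
        rw [Module.mem_annihilator.1 hf s, evalDual_zero, evalDual_zero, div_one]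
      · exact hρ s hs _ _ (hxy n (hn.trans (le_max_left _ _)))
    exact div_eq_one.1 (DFunLike.congr_fun hχ f)
  have hm : m ∈ Submodule.span (LaurentRing d) (S : Set M) := hS ▸ Submodule.mem_top
  suffices hf : ∀ f : LaurentRing d, evalDual x (f • m) = evalDual y (f • m) by simpa using hf 1
  intro f
  induction hm using Submodule.span_induction generalizing f with
  | mem s hs => exact hchar s hs f
  | zero => rw [smul_zero, evalDual_zero, evalDual_zero]
  | add m m' _ _ hm hm' => rw [smul_add, evalDual_add, evalDual_add, hm, hm']
  | smul g m _ hm => rw [smul_smul, hm]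

/-- The concrete form of expansiveness: a character that is close to `1` on the translates of a
finite set by the lattice points near `V` is trivial. -/
theorem ExpansiveAlong.exists_finset {ρ : CompatibleMetric (DualGroup M)}
    (h : ExpansiveAlong ρ (dualAction (d := d) M) V) :
    ∃ S : Finset M, ∃ U ∈ 𝓝 (1 : Circle), ∃ T : ℝ, ∀ x : DualGroup M,
      (∀ n, codist V n ≤ T → ∀ s ∈ S, evalDual x (monom n • s) ∈ U) → x = 1 := by
  obtain ⟨ε, hε, t, ht, hexp⟩ := h
  obtain ⟨S, U, hU, hS⟩ := exists_finset_evalDual_mem (ρ.closedBall_mem_nhds 1 hε)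
  refine ⟨S, U, hU, t, fun x hx => hexp x 1 ?_⟩
  rw [distAlong_le_iff _ _ ht.le]
  intro n hn
  rw [dualAction_one]
  exact hS _ fun s hs => hx n hn s hs

/-- A character trivial on this subgroup satisfies the smallness hypothesis, hence is trivial; but
characters of the quotient separate points. -/
theorem closure_eq_top_of_forall_evalDual {S : Finset M} {U : Set Circle}
    (hU : U ∈ 𝓝 (1 : Circle)) {T : ℝ} (h : ∀ x : DualGroup M,
      (∀ n, codist V n ≤ T → ∀ s ∈ S, evalDual x (monom n • s) ∈ U) → x = 1) :
    AddSubgroup.closure {m : M | ∃ n : Fin d → ℤ, codist V n ≤ T ∧ ∃ s ∈ S, m = monom n • s}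
      = ⊤ := by
  set N := AddSubgroup.closure
    {m : M | ∃ n : Fin d → ℤ, codist V n ≤ T ∧ ∃ s ∈ S, m = monom n • s} with hN
  rw [AddSubgroup.eq_top_iff']
  intro m
  by_contra hm
  obtain ⟨c, hc⟩ := exists_circle_character (a := (m : M ⧸ N))
    (mt (QuotientAddGroup.eq_zero_iff m).1 hm)
  have h1 : dualOf (c.comp (QuotientAddGroup.mk' N)) = 1 := by
    refine h _ fun n hn s hs => ?_
    have h2 : (QuotientAddGroup.mk' N) (monom n • s) = 0 :=
      (QuotientAddGroup.eq_zero_iff _).2 (AddSubgroup.subset_closure ⟨n, hn, s, hs, rfl⟩)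
    rw [evalDual_dualOf, AddMonoidHom.comp_apply, h2, map_zero]
    exact mem_of_mem_nhds hU
  have h3 := congrArg (fun x => evalDual x m) h1
  exact hc h3

/-- The elements of `R_H` supported in the interior of the half-space `H`. -/
def strictIdeal (v : Euc d) : Ideal (subringOf (halfSpace v)) where
  carrier := {f | StrictSupport v f.1}
  zero_mem' := StrictSupport.zero
  add_mem' := fun hf hg => StrictSupport.add hf hg
  smul_mem' := fun f _ hg => (mem_subringOf_halfSpace.1 f.2).mul_strict hg

/-- Shifting by u^(jk) moves all generators u^n • s strictly inside the half-space; as u^(jk) is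
invertible, all of M lies in I • N, with I the ideal `strictIdeal v` and N the R_H-span of S.
Nakayama gives r in 1 + I killing N, hence M. -/
theorem exists_mem_annihilator_of_closure_eq_top {S : Finset M} {T : ℝ}
    (h : AddSubgroup.closure {m : M | ∃ n : Fin d → ℤ, codist V n ≤ T ∧ ∃ s ∈ S, m = monom n • s}
      = ⊤) {v : Euc d} (hV : v ∈ Vᗮ) (hv : ‖v‖ = 1) :
    ∃ f ∈ oneSubStrict v, f ∈ Module.annihilator (LaurentRing d) M := by
  obtain ⟨k, hk⟩ := exists_inner_neg hv
  -- Points n within T of V satisfy n · v ≤ T, so j must make jk · v < -T.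
  obtain ⟨j, hj⟩ := exists_nat_gt (T / -inner ℝ (latticePoint k) v)
  rw [div_lt_iff₀ (neg_pos.2 hk)] at hj
  let N := Submodule.span (subringOf (halfSpace v)) (S : Set M)
  have hmem : ∀ m : M, m ∈ strictIdeal v • N := by
    have hshift : ∀ m : M, monom (j • k) • m ∈ strictIdeal v • N := by
      intro m
      have hm : m ∈ AddSubgroup.closure
          {m : M | ∃ n : Fin d → ℤ, codist V n ≤ T ∧ ∃ s ∈ S, m = monom n • s} := by
        rw [h]; trivial
      induction hm using AddSubgroup.closure_induction with
      | mem m hm =>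
        obtain ⟨n, hn, s, hs, rfl⟩ := hm
        rw [smul_smul, ← monom_add]
        have hstrict : StrictSupport v (monom (j • k + n)) := by
          intro l hl
          rw [coeff_support_monom _ hl, latticePoint_add, latticePoint_nsmul, inner_add_left,
            real_inner_smul_left]
          have := inner_le_codist V hV n
          rw [hv, mul_one] at this
          linarith
        exact Submodule.smul_mem_smul (I := strictIdeal v) (N := N)
          (r := ⟨monom (j • k + n), mem_subringOf_halfSpace.2 hstrict.weak⟩) hstrict
          (Submodule.subset_span hs)
      | zero => rw [smul_zero]; exact zero_mem _
      | add x y _ _ hx hy => rw [smul_add]; exact add_mem hx hy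
      | neg x _ hx => rw [smul_neg]; exact neg_mem hx
    intro m
    have := hshift (monom (-(j • k)) • m)
    rwa [smul_smul, ← monom_add, add_neg_cancel, monom_zero, one_smul] at this
  obtain ⟨⟨r, hr⟩, hr1, hrN⟩ :=
    Submodule.exists_sub_one_mem_and_smul_eq_zero_of_fg_of_le_smul (strictIdeal v) N
      (Submodule.fg_span S.finite_toSet) (fun m _ => hmem m)
  refine ⟨r, ?_, Module.mem_annihilator.2 fun m => hrN m (Submodule.smul_le_right (hmem m))⟩
  have h2 : StrictSupport v (r - 1) := hr1
  rw [mem_oneSubStrict, ← neg_sub]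
  exact h2.neg

theorem logAbs_notMem_of_forall_evalDual [IsNoetherian (LaurentRing d) M] {S : Finset M}
    {U : Set Circle} (hU : U ∈ 𝓝 (1 : Circle)) {T : ℝ}
    (h : ∀ x : DualGroup M,
      (∀ n, codist V n ≤ T → ∀ s ∈ S, evalDual x (monom n • s) ∈ U) → x = 1)
    {z : Fin d → ℂˣ} (hz : z ∈ variety (Module.annihilator (LaurentRing d) M)) :
    logAbs z ∉ Vᗮ := by
  intro hV
  obtain ⟨φ, hφ0, hφ⟩ := exists_eigenfunctional hz
  obtain ⟨m, hm⟩ : ∃ m, φ m ≠ 0 := by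
    by_contra! hcon
    exact hφ0 (AddMonoidHom.ext hcon)
  have hexp : Filter.Tendsto Circle.exp (𝓝 0) (𝓝 1) := by
    simpa using Circle.exp.continuous.tendsto 0
  obtain ⟨δ, hδ, hδU⟩ := Metric.mem_nhds_iff.1 (hexp hU)
  -- K bounds |φ(u^n • s)/φ(m)| for n within T of V: there |z^n| ≤ exp(T‖log|z|‖), because log|z| is
  -- in Vᗮ.
  set K : ℝ := Real.exp (T * ‖logAbs z‖) * (∑ s ∈ S, ‖φ s‖) / ‖φ m‖ with hK
  have hK0 : 0 ≤ K := div_nonneg (mul_nonneg (Real.exp_pos _).le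
    (Finset.sum_nonneg fun _ _ => norm_nonneg _)) (norm_nonneg _)
  -- The bound rK < δ keeps the character inside U on the translates, while 0 < r ≤ 1 < 2π makes its
  -- value exp(ir) at m differ from 1.
  set r : ℝ := min 1 (δ / (K + 1)) with hr
  have hr0 : 0 < r := lt_min one_pos (by positivity)
  have hrK : r * K < δ := by
    have h1 : r * (K + 1) ≤ δ := by
      rw [← le_div_iff₀ (by linarith)]; exact min_le_right _ _
    linarith
  let c : M →+ Additive Circle :=
    { toFun := fun l => Additive.ofMul (Circle.exp (r * (φ l / φ m).re))
      map_zero' := by simp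
      map_add' := fun l l' => by
        rw [map_add, add_div, Complex.add_re, mul_add, Circle.exp_add, ofMul_mul] }
  have hc : dualOf c = 1 := by
    refine h _ fun n hn s hs => ?_
    change Circle.exp (r * (φ (monom n • s) / φ m).re) ∈ U
    refine hδU ?_
    rw [mem_ball_zero_iff, Real.norm_eq_abs, abs_mul, abs_of_pos hr0]
    refine lt_of_le_of_lt (mul_le_mul_of_nonneg_left ?_ hr0.le) hrK
    refine (Complex.abs_re_le_norm _).trans ?_
    rw [norm_div, hφ, norm_mul, evalHom_monom, norm_prod_zpow, hK]
    refine div_le_div_of_nonneg_right ?_ (norm_nonneg _)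
    refine mul_le_mul (Real.exp_le_exp.2 ?_) (Finset.single_le_sum (f := fun s => ‖φ s‖)
      (fun _ _ => norm_nonneg _) hs) (norm_nonneg _) (Real.exp_pos _).le
    exact (inner_le_codist V hV n).trans (mul_le_mul_of_nonneg_right hn (norm_nonneg _))
  have h2 : Circle.exp (r * (φ m / φ m).re) = 1 := congrArg (fun x => evalDual x m) hc
  rw [div_self hm, Complex.one_re, mul_one, Circle.exp_eq_one] at h2
  obtain ⟨i, hi⟩ := h2
  have hr1 : r ≤ 1 := min_le_left _ _
  have hpi := Real.pi_gt_three
  rcases le_or_gt i 0 with hi0 | hi0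
  · have : (i : ℝ) ≤ 0 := by exact_mod_cast hi0
    nlinarith
  · have : (1 : ℝ) ≤ i := by exact_mod_cast hi0
    nlinarith

theorem expansiveAlong_iff [IsNoetherian (LaurentRing d) M] (V : Submodule ℝ (Euc d))
    (ρ : CompatibleMetric (DualGroup M)) :
    ExpansiveAlong ρ (dualAction (d := d) M) V ↔
      ExpansiveIdeal V (Module.annihilator (LaurentRing d) M) := by
  refine ⟨fun h => ?_, fun h => h.expansiveAlong ρ⟩
  obtain ⟨S, U, hU, T, hS⟩ := h.exists_finset
  exact ⟨fun v hV hv => exists_mem_annihilator_of_closure_eq_top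
      (closure_eq_top_of_forall_evalDual hU hS) hV hv,
    fun z hz => logAbs_notMem_of_forall_evalDual hU hS hz⟩

end Main

end Topological

end AlgZd

end

theorem theorem8p4 (d : ℕ) (M : Type*) [AddCommGroup M] [Module (AlgZd.LaurentRing d) M]
    [IsNoetherian (AlgZd.LaurentRing d) M] (V : Submodule ℝ (AlgZd.Euc d))
    (ρ : AlgZd.CompatibleMetric (AlgZd.DualGroup M))
    (σ : ∀ p : Ideal (AlgZd.LaurentRing d),
      AlgZd.CompatibleMetric (AlgZd.DualGroup (AlgZd.LaurentRing d ⧸ p))) :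
    List.TFAE [
      AlgZd.ExpansiveAlong ρ (AlgZd.dualAction (d := d) M) (V : Set (AlgZd.Euc d)),
      ∀ p ∈ AlgZd.asc (d := d) M,
        AlgZd.ExpansiveAlong (σ p) (AlgZd.dualAction (d := d) (AlgZd.LaurentRing d ⧸ p))
          (V : Set (AlgZd.Euc d)),
      ∀ p ∈ AlgZd.asc (d := d) M,
        AlgZd.NoetherianAlong V (AlgZd.LaurentRing d ⧸ p) ∧
          (Vᗮ : Set (AlgZd.Euc d)) ∩ AlgZd.logAbs '' AlgZd.variety p = ∅] := by
  have h12 := AlgZd.expansiveAlong_iff V ρ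
  rw [AlgZd.expansiveIdeal_annihilator_iff] at h12
  tfae_have 1 ↔ 2 := by
    rw [h12]
    refine forall₂_congr fun p _ => ?_
    rw [AlgZd.expansiveAlong_iff V (σ p), Ideal.annihilator_quotient]
  tfae_have 1 ↔ 3 := by
    rw [h12]
    exact forall₂_congr fun p _ => AlgZd.expansiveIdeal_iff V p
  tfae_finish
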